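/- Let $\mathbb F$ be a field, $n\ge 0$, and let $f\in\mathbb F[x_1,\dots,x_n]$ be a multilinear polynomial (every variable has individual degree at most $1$ in $f$). For $B\subseteq\{x_1,\dots,x_n\}$ and $a\in\mathbb F^n$ let $f|_{B,a}$ be the polynomial obtained from $f$ by fixing $x_j=a_j$ for every $x_j\notin B$. A linear function is a polynomial of degree at most $1$ (constant terms are allowed), and a linear factor is a factor of degree exactly $1$. A polynomial $g$ depends on $r$ linear functions if $g=h(\ell_1,\dots,\ell_r)$ for some linear functions $\ell_1,\dots,\ell_r$ and some $h\in\mathbb F[y_1,\dots,y_r]$. For a nonzero polynomial $g$ let $\mathrm{Lin}(g)$ be the product of its linear factors (with multiplicity, unique up to a nonzero constant); the semantic rank $\Delta_{\mathrm{sem}}(g)$ is the minimal $r\in\mathbb N$ such that $g/\mathrm{Lin}(g)$ depends on $r$ linear functions, and $\Delta_{\mathrm{sem}}(0)=0$. Claim. For every $B\subseteq\{x_1,\dots,x_n\}$ there is a nonzero polynomial $\Psi_B\in\mathbb F[x_1,\dots,x_n]$ of total degree at most $4n^6$ with the following property. For every $a\in\mathbb F^n$ with $\Psi_B(a)\ne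 0$: if $\Delta_{\mathrm{sem}}(f|_{B,a})<\Delta_{\mathrm{sem}}(f)$, then there are variables $x,y,z,w\notin B$, not necessarily distinct, such that $$\Delta_{\mathrm{sem}}(f|_{B,a})<\Delta_{\mathrm{sem}}(f|_{B\cup\{x,y,z,w\},a}).$$ -/

import Mathlib

open MvPolynomial

noncomputable section

/-- A polynomial is multilinear if every variable has individual degree at most one in it. -/
def IsMultilinearPoly {n : ℕ} {F : Type*} [Field F] (f : MvPolynomial (Fin n) F) : Prop :=
  ∀ i, f.degreeOf i ≤ 1

/-- The restriction `f|_{B,a}`: every variable `x_j` with `j ∉ B` is fixed to the value `a j`. -/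
def restrictPoly {n : ℕ} {F : Type*} [Field F] (f : MvPolynomial (Fin n) F)
    (B : Finset (Fin n)) (a : Fin n → F) : MvPolynomial (Fin n) F :=
  bind₁ (fun j => if j ∈ B then X j else C (a j)) f

/-- `g` depends on `r` linear functions: `g = h(ℓ₁, …, ℓ_r)` for linear (that is, affine)
functions `ℓ₁, …, ℓ_r` and some polynomial `h` in `r` variables. -/
def DependsOnLinearFunctions {n : ℕ} {F : Type*} [Field F] (g : MvPolynomial (Fin n) F)
    (r : ℕ) : Prop :=
  ∃ ℓ : Fin r → MvPolynomial (Fin n) F, (∀ i, (ℓ i).totalDegree ≤ 1) ∧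
    ∃ h : MvPolynomial (Fin r) F, g = bind₁ ℓ h

/-- `L` is the product of the linear factors of `f`, with multiplicity, and `h` is the
quotient `f / L`: `L` is a product of polynomials of degree one, `f = L * h`, and `h` has no
factor of degree one. For `f ≠ 0` the pair `(L, h)` is unique up to multiplication by
nonzero constants. -/
def IsLinearPartDecomposition {n : ℕ} {F : Type*} [Field F]
    (f L h : MvPolynomial (Fin n) F) : Prop :=
  (∃ s : Multiset (MvPolynomial (Fin n) F), (∀ ℓ ∈ s, ℓ.totalDegree = 1) ∧ L = s.prod) ∧
    f = L * h ∧ ∀ ℓ : MvPolynomial (Fin n) F, ℓ.totalDegree = 1 → ¬ ℓ ∣ h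

/-- The semantic rank of `f`: the minimal number `r` such that `f / Lin(f)`, where `Lin(f)` is
the product of the linear factors of `f`, depends on `r` linear functions.
The zero polynomial gets rank `0`. -/
def semRank {n : ℕ} {F : Type*} [Field F] (f : MvPolynomial (Fin n) F) : ℕ :=
  sInf {r | ∃ L h : MvPolynomial (Fin n) F,
    IsLinearPartDecomposition f L h ∧ DependsOnLinearFunctions h r}

end

/-! For a polynomial without linear factors, the semantic rank is the codimension of its space of
directions of invariance, that is, of the `v` with `g(x + t v) = g(x)` identically in `t`
(`invCodim_le_of_dependsOn`, `dependsOn_invCodim`, `semRank_eq_invCodim`). The irreducible factors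
of a multilinear polynomial have disjoint variables, and the rank is additive over such factors, so
it suffices to treat an irreducible `g` and to add the variables to `B` within a single factor.

A restriction of an irreducible `g` could acquire linear factors. This is excluded by asking that
the polynomials `g ∂ᵢ∂ⱼg - ∂ᵢg ∂ⱼg` not vanish at `a`: they are nonzero for irreducible multilinear
`g`, commute with restriction, and vanish when `i` and `j` occur in different factors of a product
with disjoint variables. So every restriction of degree at least two has rank equal to its
invariance codimension (`semRank_restrictHom`).

The core is `exists_polynomial_of_invCodim_lt`, stated for sets of polynomials. If freeing variables
does not raise the codimension, the larger restriction is an affine substitution of the smaller one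
(`exists_affine_of_invCodim_le`), so the rank of the first derivatives does not rise either. Take a
maximal `J ⊆ B` such that the derivatives `∂ⱼ`, `j ∈ J`, are generically independent on `B`. If
freeing some `j ∉ J` and some `z` makes `J ∪ {j}` generically independent, the derivative rank
rises, hence so does the codimension. Otherwise every `∂ⱼ` is a combination of the `∂ᵢ`, `i ∈ J`,
whose coefficients avoid each variable in turn and so are constants (`exists_constant_relation`). A
linear shear then makes all derivatives outside `J` vanish. In characteristic zero the sheared
polynomials involve only variables of `J ⊆ B`, and the restriction loses nothing. In characteristic
`p` they are polynomials in the variables of `J` and the `p`-th powers of the others; extracting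
`p`-th roots of their coefficients gives a set of polynomials of degree at most `d / p` whose
codimension differs by `|J|`, and induction on the degree finishes (`exists_reduced_set`).

Two extra variables are enough, so the four variables of the theorem are chosen with repetitions. -/

noncomputable section

namespace SemanticRank

variable {n : ℕ} {F : Type*} [Field F]

/-! ### Directions of invariance and their codimension. -/

/-- The formal translation `g(x) ↦ g(x + t v)`. -/
def formalShift (v : Fin n → F) :
    MvPolynomial (Fin n) F →ₐ[F] Polynomial (MvPolynomial (Fin n) F) :=
  aeval fun i => Polynomial.C (X i) + Polynomial.C (C (v i)) * Polynomial.X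

lemma formalShift_X (v : Fin n → F) (i : Fin n) :
    formalShift v (X i) = Polynomial.C (X i) + Polynomial.C (C (v i)) * Polynomial.X := by
  simp [formalShift]

lemma formalShift_C (v : Fin n → F) (c : F) :
    formalShift v (C c) = Polynomial.C (C c) := by
  simp [formalShift, Polynomial.algebraMap_apply]

lemma formalShift_spec {A : Type*} [CommRing A] [Algebra F A] (v : Fin n → F)
    (x : Fin n → A) (t : A) (g : MvPolynomial (Fin n) F) :
    Polynomial.eval₂ (aeval x : MvPolynomial (Fin n) F →ₐ[F] A).toRingHom t (formalShift v g) =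
      aeval (fun i => x i + algebraMap F A (v i) * t) g := by
  have := MvPolynomial.ringHom_ext
    (f := (Polynomial.eval₂RingHom (aeval x : MvPolynomial (Fin n) F →ₐ[F] A).toRingHom t).comp
      (formalShift v).toRingHom)
    (g := (aeval (fun i => x i + algebraMap F A (v i) * t) :
      MvPolynomial (Fin n) F →ₐ[F] A).toRingHom)
    (fun r => by simp [Polynomial.algebraMap_apply]) (fun i => by simp [formalShift_X])
  exact congrArg (fun φ : MvPolynomial (Fin n) F →+* A => φ g) this

/-- `v` is a direction of invariance of `g`: formally, `g(x + t v) = g(x)`. -/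
def InvariantAlong (g : MvPolynomial (Fin n) F) (v : Fin n → F) : Prop :=
  formalShift v g = Polynomial.C g

lemma InvariantAlong.aeval_eq {A : Type*} [CommRing A] [Algebra F A]
    {g : MvPolynomial (Fin n) F} {v : Fin n → F} (h : InvariantAlong g v) (x : Fin n → A) (t : A) :
    aeval (fun i => x i + algebraMap F A (v i) * t) g = aeval x g := by
  rw [← formalShift_spec, h]
  simp

lemma invariantAlong_zero (g : MvPolynomial (Fin n) F) : InvariantAlong g 0 := by
  unfold InvariantAlong
  have := MvPolynomial.ringHom_ext
    (f := (formalShift (0 : Fin n → F)).toRingHom)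
    (g := (Polynomial.C : MvPolynomial (Fin n) F →+* _))
    (fun r => by simp [Polynomial.algebraMap_apply]) (fun i => by simp [formalShift_X])
  exact congrArg (fun φ : MvPolynomial (Fin n) F →+* _ => φ g) this

lemma formalShift_eq_aeval (v : Fin n → F) (g : MvPolynomial (Fin n) F) :
    formalShift v g =
      aeval (fun i => Polynomial.C (X i) + Polynomial.C (C (v i)) * Polynomial.X) g := rfl

lemma C_eq_aeval (g : MvPolynomial (Fin n) F) :
    Polynomial.C g = aeval (fun i => Polynomial.C (X i)) g := by
  have h := invariantAlong_zero g
  rw [InvariantAlong, formalShift_eq_aeval] at h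
  simpa using h.symm

lemma InvariantAlong.add {g : MvPolynomial (Fin n) F} {v w : Fin n → F}
    (hv : InvariantAlong g v) (hw : InvariantAlong g w) : InvariantAlong g (v + w) := by
  have h1 := hv.aeval_eq (A := Polynomial (MvPolynomial (Fin n) F))
    (fun i => Polynomial.C (X i) + Polynomial.C (C (w i)) * Polynomial.X) Polynomial.X
  rw [InvariantAlong, formalShift_eq_aeval] at hw ⊢
  refine Eq.trans (congrArg (fun z : Fin n → Polynomial (MvPolynomial (Fin n) F) =>
    aeval (R := F) z g) (funext fun i => ?_)) (h1.trans hw)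
  simp only [Polynomial.algebraMap_apply, MvPolynomial.algebraMap_eq, Pi.add_apply, map_add]
  ring

lemma InvariantAlong.smul {g : MvPolynomial (Fin n) F} {v : Fin n → F} (c : F)
    (hv : InvariantAlong g v) : InvariantAlong g (c • v) := by
  have h1 := hv.aeval_eq (A := Polynomial (MvPolynomial (Fin n) F))
    (fun i => Polynomial.C (X i)) (Polynomial.C (C c) * Polynomial.X)
  rw [InvariantAlong, formalShift_eq_aeval]
  refine Eq.trans (congrArg (fun z : Fin n → Polynomial (MvPolynomial (Fin n) F) =>
    aeval (R := F) z g) (funext fun i => ?_)) (h1.trans (C_eq_aeval g).symm)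
  simp only [Polynomial.algebraMap_apply, MvPolynomial.algebraMap_eq, Pi.smul_apply, smul_eq_mul,
    map_mul]
  ring

/-- The space of common directions of invariance of a set of polynomials. -/
def invSpace (G : Set (MvPolynomial (Fin n) F)) : Submodule F (Fin n → F) where
  carrier := {v | ∀ g ∈ G, InvariantAlong g v}
  zero_mem' := fun g _ => invariantAlong_zero g
  add_mem' := fun hv hw g hg => (hv g hg).add (hw g hg)
  smul_mem' := fun c _ hv g hg => (hv g hg).smul c

lemma mem_invSpace {G : Set (MvPolynomial (Fin n) F)} {v : Fin n → F} :
    v ∈ invSpace G ↔ ∀ g ∈ G, InvariantAlong g v := Iff.rfl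

lemma mem_invSpace_singleton {g : MvPolynomial (Fin n) F} {v : Fin n → F} :
    v ∈ invSpace {g} ↔ InvariantAlong g v := by simp [mem_invSpace]

/-- The codimension of the space of common directions of invariance. -/
def invCodim (G : Set (MvPolynomial (Fin n) F)) : ℕ :=
  Module.finrank F ((Fin n → F) ⧸ invSpace G)

lemma invCodim_add_finrank (G : Set (MvPolynomial (Fin n) F)) :
    invCodim G + Module.finrank F (invSpace G) = n := by
  simpa [invCodim] using Submodule.finrank_quotient_add_finrank (invSpace G)

lemma invCodim_eq_of_invSpace_eq {G H : Set (MvPolynomial (Fin n) F)}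
    (h : invSpace G = invSpace H) : invCodim G = invCodim H := by
  rw [invCodim, h, invCodim]

lemma aeval_add_sum_eq {A : Type*} [CommRing A] [Algebra F A] {ι : Type*}
    {g : MvPolynomial (Fin n) F} (s : Finset ι) (w : ι → Fin n → F)
    (hw : ∀ j ∈ s, InvariantAlong g (w j)) (x : Fin n → A) (t : ι → A) :
    aeval (fun i => x i + ∑ j ∈ s, algebraMap F A (w j i) * t j) g = aeval x g := by
  classical
  induction s using Finset.induction_on with
  | empty => simp
  | insert a s ha ih =>
    refine Eq.trans ?_ (((hw a (Finset.mem_insert_self a s)).aeval_eq _ (t a)).trans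
      (ih fun j hj => hw j (Finset.mem_insert_of_mem hj)))
    congr 2
    funext i
    rw [Finset.sum_insert ha]
    ring

/-- The coefficients of the degree one part of a polynomial. -/
def linCoeff (g : MvPolynomial (Fin n) F) (j : Fin n) : F := coeff (Finsupp.single j 1) g

lemma eq_of_totalDegree_le_one {g : MvPolynomial (Fin n) F} (hg : g.totalDegree ≤ 1) :
    g = C (coeff 0 g) + ∑ j, C (linCoeff g j) * X j := by
  classical
  ext m
  simp only [coeff_add, coeff_sum, coeff_C_mul, coeff_C]
  by_cases hm0 : m = 0
  · subst hm0
    simp [coeff_X]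
  rw [if_neg (Ne.symm hm0), zero_add]
  by_cases hm : m.degree = 1
  · obtain ⟨k, rfl⟩ : ∃ k, m = Finsupp.single k 1 := by
      have : m ∈ Set.range (fun a : Fin n ↦ Finsupp.single a 1) := by
        rw [Finsupp.range_single_one]
        exact hm
      obtain ⟨k, hk⟩ := this
      exact ⟨k, hk.symm⟩
    rw [Finset.sum_eq_single k]
    · simp [linCoeff]
    · intro b _ hb
      rw [coeff_X, if_neg, mul_zero]
      intro h
      exact hb ((Finsupp.single_left_inj one_ne_zero).1 h)
    · simp
  · have hm2 : 1 < m.degree := by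
      have : m.degree ≠ 0 := by
        simpa [Finsupp.degree_eq_zero_iff] using hm0
      omega
    rw [coeff_eq_zero_of_totalDegree_lt (lt_of_le_of_lt hg hm2)]
    symm
    apply Finset.sum_eq_zero
    intro j _
    rw [coeff_X, if_neg, mul_zero]
    rintro rfl
    simp at hm

lemma formalShift_of_totalDegree_le_one {g : MvPolynomial (Fin n) F} (hg : g.totalDegree ≤ 1)
    (v : Fin n → F) :
    formalShift v g = Polynomial.C g +
      Polynomial.C (C (∑ j, linCoeff g j * v j)) * Polynomial.X := by
  conv_lhs => rw [eq_of_totalDegree_le_one hg]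
  conv_rhs => rw [eq_of_totalDegree_le_one hg]
  have : ∀ j, linCoeff (C (coeff 0 g) + ∑ j, C (linCoeff g j) * X j) j = linCoeff g j := by
    intro j
    rw [← eq_of_totalDegree_le_one hg]
  simp only [this, map_add, map_sum, map_mul, formalShift_X, formalShift_C, Finset.sum_mul,
    mul_add, Finset.sum_add_distrib, add_assoc, mul_assoc]

lemma formalShift_coeff_zero (v : Fin n → F) (g : MvPolynomial (Fin n) F) :
    (formalShift v g).coeff 0 = g := by
  have h := formalShift_spec v (X : Fin n → MvPolynomial (Fin n) F) 0 g
  simp only [mul_zero, add_zero] at h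
  rw [Polynomial.eval₂_at_zero] at h
  simpa using h

lemma formalShift_ne_zero (v : Fin n → F) {g : MvPolynomial (Fin n) F} (hg : g ≠ 0) :
    formalShift v g ≠ 0 := by
  intro h
  apply hg
  rw [← formalShift_coeff_zero v g, h, Polynomial.coeff_zero]

lemma invariantAlong_iff_natDegree {v : Fin n → F} {g : MvPolynomial (Fin n) F} :
    InvariantAlong g v ↔ (formalShift v g).natDegree = 0 := by
  constructor
  · intro h
    rw [h, Polynomial.natDegree_C]
  · intro h
    rw [InvariantAlong, Polynomial.eq_C_of_natDegree_eq_zero h, formalShift_coeff_zero]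

/-- Invariance means degree zero in `t`, and the degree in `t` is additive over a domain. -/
lemma invariantAlong_mul_iff {v : Fin n → F} {f g : MvPolynomial (Fin n) F} (hf : f ≠ 0)
    (hg : g ≠ 0) : InvariantAlong (f * g) v ↔ InvariantAlong f v ∧ InvariantAlong g v := by
  simp only [invariantAlong_iff_natDegree, map_mul]
  rw [Polynomial.natDegree_mul (formalShift_ne_zero v hf) (formalShift_ne_zero v hg)]
  omega

lemma invariantAlong_of_vars {v : Fin n → F} {g : MvPolynomial (Fin n) F}
    (h : ∀ i ∈ g.vars, v i = 0) : InvariantAlong g v := by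
  have := MvPolynomial.hom_congr_vars (f₁ := (formalShift v).toRingHom)
    (f₂ := (Polynomial.C : MvPolynomial (Fin n) F →+* _)) (p₁ := g) (p₂ := g)
    (by ext r; simp [Polynomial.algebraMap_apply])
    (fun i hi _ => by simp [formalShift_X, h i hi]) rfl
  exact this

/-- The subspace of vectors supported on a set of coordinates. -/
def coordSpace (S : Finset (Fin n)) : Submodule F (Fin n → F) where
  carrier := {v | ∀ i ∉ S, v i = 0}
  zero_mem' := fun _ _ => rfl
  add_mem' := fun hv hw i hi => by simp [hv i hi, hw i hi]
  smul_mem' := fun c _ hv i hi => by simp [hv i hi]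

lemma mem_coordSpace {S : Finset (Fin n)} {v : Fin n → F} :
    v ∈ (coordSpace S : Submodule F (Fin n → F)) ↔ ∀ i ∉ S, v i = 0 := Iff.rfl

lemma sup_eq_top_of_coordSpace_le {S : Finset (Fin n)} {U W : Submodule F (Fin n → F)}
    (hU : coordSpace S ≤ U) (hW : coordSpace Sᶜ ≤ W) : U ⊔ W = ⊤ := by
  classical
  rw [eq_top_iff]
  intro v _
  rw [Submodule.mem_sup]
  refine ⟨fun i => if i ∈ S then v i else 0, hU ?_, fun i => if i ∈ S then 0 else v i, hW ?_, ?_⟩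
  · intro i hi
    simp [hi]
  · intro i hi
    simp at hi
    simp [hi]
  · ext i
    by_cases hi : i ∈ S <;> simp [hi]

lemma coordSpace_compl_vars_le (g : MvPolynomial (Fin n) F) :
    coordSpace (g.vars)ᶜ ≤ invSpace {g} := by
  intro v hv
  rw [mem_invSpace_singleton]
  exact invariantAlong_of_vars fun i hi => hv i (by simpa using hi)

lemma coordSpace_mono {S T : Finset (Fin n)} (h : S ⊆ T) :
    (coordSpace S : Submodule F (Fin n → F)) ≤ coordSpace T :=
  fun _ hv i hi => hv i fun hS => hi (h hS)

/-- The invariance space of a product is the intersection of the two. Each contains the coordinate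
vectors of the variables missing from its factor, so together they span everything and the
codimensions add. -/
lemma invCodim_mul_of_disjoint {f g : MvPolynomial (Fin n) F} (hf : f ≠ 0) (hg : g ≠ 0)
    (hd : Disjoint f.vars g.vars) : invCodim {f * g} = invCodim {f} + invCodim {g} := by
  have h1 : invSpace {f * g} = invSpace {f} ⊓ invSpace {g} := by
    ext v
    simp only [Submodule.mem_inf, mem_invSpace_singleton, invariantAlong_mul_iff hf hg]
  have h2 : invSpace {f} ⊔ invSpace {g} = ⊤ := by
    refine sup_eq_top_of_coordSpace_le (S := (f.vars)ᶜ) (coordSpace_compl_vars_le f) ?_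
    refine le_trans (coordSpace_mono ?_) (coordSpace_compl_vars_le g)
    rw [compl_compl]
    intro i hi
    simpa using Finset.disjoint_left.1 hd hi
  have h3 := Submodule.finrank_sup_add_finrank_inf_eq (invSpace {f}) (invSpace {g})
  rw [h2, finrank_top, Module.finrank_fintype_fun_eq_card, Fintype.card_fin, ← h1] at h3
  have := invCodim_add_finrank {f}
  have := invCodim_add_finrank {g}
  have := invCodim_add_finrank {f * g}
  omega

/-- The common kernel of the linear parts of the `ℓ k` consists of directions of invariance and has
codimension at most `r`. -/
lemma invCodim_le_of_dependsOn {g : MvPolynomial (Fin n) F} {r : ℕ}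
    (h : DependsOnLinearFunctions g r) : invCodim {g} ≤ r := by
  obtain ⟨ℓ, hℓ, H, rfl⟩ := h
  let φ : (Fin n → F) →ₗ[F] (Fin r → F) :=
    { toFun := fun v k => ∑ j, linCoeff (ℓ k) j * v j
      map_add' := fun v w => by ext k; simp [mul_add, Finset.sum_add_distrib]
      map_smul' := fun c v => by
        ext k
        simp only [Pi.smul_apply, smul_eq_mul, RingHom.id_apply, Finset.mul_sum]
        exact Finset.sum_congr rfl fun j _ => by ring }
  have hker : LinearMap.ker φ ≤ invSpace {bind₁ ℓ H} := by
    intro v hv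
    rw [mem_invSpace_singleton, InvariantAlong]
    have hk : ∀ k, formalShift v (ℓ k) = Polynomial.C (ℓ k) := by
      intro k
      have : ∑ j, linCoeff (ℓ k) j * v j = 0 := congrFun (LinearMap.mem_ker.1 hv) k
      rw [formalShift_of_totalDegree_le_one (hℓ k), this]
      simp
    have := MvPolynomial.ringHom_ext
      (f := ((formalShift v).toRingHom).comp (bind₁ ℓ).toRingHom)
      (g := (Polynomial.C : MvPolynomial (Fin n) F →+* _).comp (bind₁ ℓ).toRingHom)
      (fun r => by simp [Polynomial.algebraMap_apply]) (fun i => by simp [hk])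
    exact congrArg (fun φ : MvPolynomial (Fin r) F →+* _ => φ H) this
  have h1 := Submodule.finrank_mono hker
  have h2 := LinearMap.finrank_range_add_finrank_ker φ
  have h3 := Submodule.finrank_le (LinearMap.range φ)
  simp only [Module.finrank_fintype_fun_eq_card, Fintype.card_fin] at h2 h3
  have := invCodim_add_finrank {bind₁ ℓ H}
  omega

/-- Split `x` along the invariance space and a complement `K`: the first component does not affect
`g`, and the coordinates of the second in a basis of `K` are the required linear functions. -/
lemma dependsOn_invCodim (g : MvPolynomial (Fin n) F) :
    DependsOnLinearFunctions g (invCodim {g}) := by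
  obtain ⟨K, hK⟩ := Submodule.exists_isCompl (invSpace {g})
  have hr : Module.finrank F K = invCodim {g} := by
    have := Submodule.finrank_add_eq_of_isCompl hK
    simp only [Module.finrank_fintype_fun_eq_card, Fintype.card_fin] at this
    have := invCodim_add_finrank {g}
    omega
  let c : Module.Basis (Fin (invCodim {g})) F K := Module.finBasisOfFinrankEq F K hr
  have hdec : ∀ j : Fin n, ∃ α : Fin (invCodim {g}) → F, ∃ w ∈ invSpace {g},
      (Pi.single j 1 : Fin n → F) = w + ∑ k, α k • (c k : Fin n → F) := by
    intro j
    have : (Pi.single j 1 : Fin n → F) ∈ invSpace {g} ⊔ K := by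
      rw [hK.sup_eq_top]; trivial
    obtain ⟨w, hw, y, hy, hwy⟩ := Submodule.mem_sup.1 this
    refine ⟨c.repr ⟨y, hy⟩, w, hw, ?_⟩
    have := congrArg K.subtype (c.sum_repr ⟨y, hy⟩)
    rw [map_sum] at this
    simp only [map_smul, Submodule.subtype_apply] at this
    rw [← hwy, this]
  choose α w hw hdec using hdec
  refine ⟨fun k => ∑ j, C (α j k) * X j, fun k => ?_,
    aeval (fun i => ∑ k, X k * C ((c k : Fin n → F) i)) g, ?_⟩
  · refine totalDegree_finsetSum_le fun j _ => ?_
    refine (totalDegree_mul _ _).trans ?_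
    simp
  · have h1 := aeval_add_sum_eq (A := MvPolynomial (Fin n) F) Finset.univ w
      (fun j _ => mem_invSpace_singleton.1 (hw j))
      (fun i => ∑ k, (∑ j, C (α j k) * X j) * C ((c k : Fin n → F) i)) (fun j => X j)
    have h2 : (fun i => (∑ k, (∑ j, C (α j k) * X j) * C ((c k : Fin n → F) i)) +
        ∑ j, algebraMap F (MvPolynomial (Fin n) F) (w j i) * X j) = X := by
      funext i
      have : ∀ j, C ((Pi.single j 1 : Fin n → F) i) * (X j : MvPolynomial (Fin n) F) =
          algebraMap F (MvPolynomial (Fin n) F) (w j i) * X j +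
            ∑ k, C (α j k) * X j * C ((c k : Fin n → F) i) := by
        intro j
        rw [hdec j]
        simp only [Pi.add_apply, Finset.sum_apply, Pi.smul_apply, smul_eq_mul, map_add, map_sum,
          map_mul, add_mul, Finset.sum_mul, MvPolynomial.algebraMap_eq]
        congr 1
        exact Finset.sum_congr rfl fun k _ => by ring
      have h3 := Finset.sum_congr (rfl : (Finset.univ : Finset (Fin n)) = Finset.univ)
        fun j _ => this j
      rw [Finset.sum_add_distrib, Finset.sum_eq_single i] at h3
      · simp only [Pi.single_eq_same, map_one, one_mul] at h3
        rw [h3, add_comm]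
        congr 1
        rw [Finset.sum_comm]
        simp only [Finset.sum_mul]
      · intro b _ hb
        simp [Ne.symm hb]
      · simp
    rw [h2] at h1
    have h4 : aeval (X : Fin n → MvPolynomial (Fin n) F) g = g := by simp
    rw [h4] at h1
    conv_lhs => rw [h1]
    rw [← AlgHom.comp_apply]
    refine congrArg (fun φ : MvPolynomial (Fin n) F →ₐ[F] _ => φ g) ?_
    ext1 i
    simp

/-! ### Linear factors, and the semantic rank as an invariance codimension. -/

lemma isUnit_of_totalDegree_eq_zero {g : MvPolynomial (Fin n) F} (hg : g ≠ 0)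
    (h : g.totalDegree = 0) : IsUnit g := by
  rw [totalDegree_eq_zero_iff_eq_C] at h
  rw [h]
  refine IsUnit.map C (isUnit_iff_ne_zero.2 ?_)
  rintro h0
  rw [h0, map_zero] at h
  exact hg h

lemma totalDegree_eq_zero_of_isUnit {g : MvPolynomial (Fin n) F} (h : IsUnit g) :
    g.totalDegree = 0 := by
  have := totalDegree_le_of_dvd_of_isDomain (isUnit_iff_dvd_one.1 h) one_ne_zero
  simpa using this

lemma prime_of_totalDegree_eq_one {ℓ : MvPolynomial (Fin n) F} (h : ℓ.totalDegree = 1) :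
    Prime ℓ := by
  have hℓ : ℓ ≠ 0 := by
    rintro rfl
    simp at h
  rw [← irreducible_iff_prime]
  refine ⟨fun hu => by simp [totalDegree_eq_zero_of_isUnit hu] at h, fun a b hab => ?_⟩
  have ha : a ≠ 0 := by rintro rfl; simp_all
  have hb : b ≠ 0 := by rintro rfl; simp_all
  rw [hab, totalDegree_mul_of_isDomain ha hb] at h
  rcases Nat.eq_zero_or_pos a.totalDegree with h0 | h0
  · exact Or.inl (isUnit_of_totalDegree_eq_zero ha h0)
  · exact Or.inr (isUnit_of_totalDegree_eq_zero hb (by omega))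

lemma vars_subset_of_dvd {g f : MvPolynomial (Fin n) F} (hf : f ≠ 0) (h : g ∣ f) :
    g.vars ⊆ f.vars := by
  obtain ⟨k, rfl⟩ := h
  intro i hi
  rw [mem_vars_iff_degreeOf_ne_zero] at hi ⊢
  rw [degreeOf_mul_eq (left_ne_zero_of_mul hf) (right_ne_zero_of_mul hf)]
  omega

lemma exists_linearPartDecomposition {f : MvPolynomial (Fin n) F} (hf : f ≠ 0) :
    ∃ L h, IsLinearPartDecomposition f L h := by
  induction f using WfDvdMonoid.induction_on_irreducible with
  | zero => exact absurd rfl hf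
  | unit u hu =>
    refine ⟨1, u, ⟨0, by simp⟩, by simp, fun ℓ hℓ hd => ?_⟩
    exact (prime_of_totalDegree_eq_one hℓ).not_isUnit (isUnit_of_dvd_unit hd hu)
  | mul a p ha hp ih =>
    obtain ⟨L, h, ⟨s, hs, rfl⟩, hdec, hno⟩ := ih ha
    by_cases hp1 : p.totalDegree = 1
    · refine ⟨p * s.prod, h, ⟨p ::ₘ s, ?_, by simp⟩, by rw [hdec, mul_assoc], hno⟩
      intro ℓ hℓ
      rcases Multiset.mem_cons.1 hℓ with rfl | hℓ
      · exact hp1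
      · exact hs ℓ hℓ
    · refine ⟨s.prod, p * h, ⟨s, hs, rfl⟩, by rw [hdec]; ring, fun ℓ hℓ hd => ?_⟩
      rcases (prime_of_totalDegree_eq_one hℓ).dvd_or_dvd hd with hd | hd
      · obtain ⟨u, hu⟩ := hd
        rcases hp.isUnit_or_isUnit hu with h1 | h1
        · exact (prime_of_totalDegree_eq_one hℓ).not_isUnit h1
        · apply hp1
          rw [hu, totalDegree_mul_of_isDomain (prime_of_totalDegree_eq_one hℓ).ne_zero h1.ne_zero,
            totalDegree_eq_zero_of_isUnit h1, hℓ]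
      · exact hno ℓ hℓ hd

/-- Linear polynomials are prime, so they can be cancelled from `a` one at a time. Applied in both
directions, this makes the linear part unique up to a unit. -/
lemma multiset_prod_dvd_of_dvd_mul {s : Multiset (MvPolynomial (Fin n) F)}
    {a h : MvPolynomial (Fin n) F} (hs : ∀ ℓ ∈ s, ℓ.totalDegree = 1)
    (hno : ∀ ℓ : MvPolynomial (Fin n) F, ℓ.totalDegree = 1 → ¬ ℓ ∣ h) (hd : s.prod ∣ a * h) :
    s.prod ∣ a := by
  induction s using Multiset.induction_on generalizing a with
  | empty => simp
  | cons ℓ s ih =>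
    have hℓ := hs ℓ (Multiset.mem_cons_self ℓ s)
    have hp := prime_of_totalDegree_eq_one hℓ
    rw [Multiset.prod_cons] at hd ⊢
    obtain ⟨b, rfl⟩ : ℓ ∣ a :=
      (hp.dvd_or_dvd (dvd_of_mul_right_dvd hd)).resolve_right (hno ℓ hℓ)
    rw [mul_assoc] at hd
    exact mul_dvd_mul_left ℓ (ih (fun k hk => hs k (Multiset.mem_cons_of_mem hk))
      ((mul_dvd_mul_iff_left hp.ne_zero).1 hd))

lemma invSpace_eq_of_associated {g h : MvPolynomial (Fin n) F} (hgh : Associated g h)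
    (hg : g ≠ 0) : invSpace {g} = invSpace {h} := by
  obtain ⟨u, rfl⟩ := hgh
  ext v
  simp only [mem_invSpace_singleton, invariantAlong_mul_iff hg u.ne_zero]
  refine ⟨fun h => ⟨h, ?_⟩, fun h => h.1⟩
  refine ((invariantAlong_mul_iff u.ne_zero (u⁻¹).ne_zero).1 ?_).1
  rw [Units.mul_inv]
  exact invariantAlong_of_vars (by simp)

lemma associated_of_decompositions {f L h L' h' : MvPolynomial (Fin n) F} (hf : f ≠ 0)
    (hd : IsLinearPartDecomposition f L h) (hd' : IsLinearPartDecomposition f L' h') :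
    Associated h h' := by
  obtain ⟨⟨s, hs, rfl⟩, h1, hno⟩ := hd
  obtain ⟨⟨s', hs', rfl⟩, h1', hno'⟩ := hd'
  have hss' : Associated s.prod s'.prod := by
    apply associated_of_dvd_dvd
    · exact multiset_prod_dvd_of_dvd_mul hs hno' ⟨h, by rw [← h1', h1]⟩
    · exact multiset_prod_dvd_of_dvd_mul hs' hno ⟨h', by rw [← h1', h1]⟩
  refine Associated.of_mul_left (a := s.prod) (c := s'.prod) ?_ hss' ?_
  · exact (h1.symm.trans h1').symm ▸ Associated.refl _
  · rw [h1] at hf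
    exact left_ne_zero_of_mul hf

lemma semRank_eq_invCodim {f L h : MvPolynomial (Fin n) F} (hf : f ≠ 0)
    (hd : IsLinearPartDecomposition f L h) : semRank f = invCodim {h} := by
  apply le_antisymm
  · exact Nat.sInf_le ⟨L, h, hd, dependsOn_invCodim h⟩
  · refine le_csInf ⟨_, L, h, hd, dependsOn_invCodim h⟩ ?_
    rintro r ⟨L', h', hd', hr⟩
    have hh : h ≠ 0 := by
      have := hd.2.1
      rw [this] at hf
      exact right_ne_zero_of_mul hf
    rw [invCodim_eq_of_invSpace_eq
      (invSpace_eq_of_associated (associated_of_decompositions hf hd hd') hh)]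
    exact invCodim_le_of_dependsOn hr

lemma semRank_mul_of_disjoint {f g : MvPolynomial (Fin n) F} (hf : f ≠ 0) (hg : g ≠ 0)
    (hd : Disjoint f.vars g.vars) : semRank (f * g) = semRank f + semRank g := by
  obtain ⟨L, h, hdf⟩ := exists_linearPartDecomposition hf
  obtain ⟨M, k, hdg⟩ := exists_linearPartDecomposition hg
  rw [semRank_eq_invCodim hf hdf, semRank_eq_invCodim hg hdg]
  have hfe := hdf.2.1
  have hge := hdg.2.1
  have hh : h ≠ 0 := right_ne_zero_of_mul (hfe ▸ hf)
  have hk : k ≠ 0 := right_ne_zero_of_mul (hge ▸ hg)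
  rw [← invCodim_mul_of_disjoint hh hk]
  · refine semRank_eq_invCodim (L := L * M) (mul_ne_zero hf hg) ⟨?_, ?_, ?_⟩
    · obtain ⟨s, hs, rfl⟩ := hdf.1
      obtain ⟨t, ht, rfl⟩ := hdg.1
      refine ⟨s + t, fun ℓ hℓ => ?_, by simp⟩
      rcases Multiset.mem_add.1 hℓ with h | h
      · exact hs ℓ h
      · exact ht ℓ h
    · rw [hfe, hge]; ring
    · intro ℓ hℓ hdvd
      rcases (prime_of_totalDegree_eq_one hℓ).dvd_or_dvd hdvd with h | h
      · exact hdf.2.2 ℓ hℓ h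
      · exact hdg.2.2 ℓ hℓ h
  · exact Finset.disjoint_of_subset_left (vars_subset_of_dvd hf (Dvd.intro_left _ hfe.symm))
      (Finset.disjoint_of_subset_right (vars_subset_of_dvd hg (Dvd.intro_left _ hge.symm)) hd)

lemma semRank_eq_of_no_linear_factor {f : MvPolynomial (Fin n) F} (hf : f ≠ 0)
    (h : ∀ ℓ : MvPolynomial (Fin n) F, ℓ.totalDegree = 1 → ¬ ℓ ∣ f) :
    semRank f = invCodim {f} :=
  semRank_eq_invCodim (L := 1) hf ⟨⟨0, by simp⟩, by simp, h⟩

lemma invCodim_eq_zero_of_vars {f : MvPolynomial (Fin n) F} (h : f.vars = ∅) :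
    invCodim {f} = 0 := by
  have h1 : invSpace {f} = ⊤ := by
    rw [eq_top_iff]
    intro v _
    rw [mem_invSpace_singleton]
    exact invariantAlong_of_vars (by simp [h])
  have := invCodim_add_finrank {f}
  rw [h1, finrank_top, Module.finrank_fintype_fun_eq_card, Fintype.card_fin] at this
  omega

lemma semRank_of_totalDegree_le_one {f : MvPolynomial (Fin n) F} (hf : f ≠ 0)
    (h : f.totalDegree ≤ 1) : semRank f = 0 := by
  rcases Nat.eq_zero_or_pos f.totalDegree with h0 | h0
  · rw [semRank_eq_of_no_linear_factor hf]
    · apply invCodim_eq_zero_of_vars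
      rw [totalDegree_eq_zero_iff_eq_C] at h0
      rw [h0, vars_C]
    · intro ℓ hℓ hd
      exact (prime_of_totalDegree_eq_one hℓ).not_isUnit
        (isUnit_of_dvd_unit hd (isUnit_of_totalDegree_eq_zero hf h0))
  · have h1 : f.totalDegree = 1 := by omega
    rw [semRank_eq_invCodim (L := f) (h := 1) hf ⟨⟨{f}, by simpa using h1, by simp⟩, by simp, ?_⟩]
    · exact invCodim_eq_zero_of_vars vars_one
    · intro ℓ hℓ hd
      exact (prime_of_totalDegree_eq_one hℓ).not_isUnit (isUnit_of_dvd_one hd)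

/-- For `n > 0` zero has no decomposition, since every linear polynomial divides the cofactor `0`,
and the infimum of the empty set is `0`. For `n = 0` there are no linear polynomials, and the value
`0` is attained. -/
lemma semRank_zero : semRank (0 : MvPolynomial (Fin n) F) = 0 := by
  by_contra hne
  obtain ⟨r, hr⟩ := Nat.nonempty_of_pos_sInf (Nat.pos_of_ne_zero hne)
  obtain ⟨L, h, hd, -⟩ := hr
  have hL : L ≠ 0 := by
    obtain ⟨s, hs, rfl⟩ := hd.1
    apply Multiset.prod_ne_zero
    intro h0
    simpa using hs 0 h0
  have h0 : h = 0 := (mul_eq_zero.1 hd.2.1.symm).resolve_left hL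
  subst h0
  by_cases hn : n = 0
  · subst hn
    apply hne
    have hz : DependsOnLinearFunctions (0 : MvPolynomial (Fin 0) F) 0 :=
      ⟨fun _ => 0, by simp, 0, by simp⟩
    exact Nat.le_zero.1 (Nat.sInf_le ⟨L, 0, hd, hz⟩)
  · exact hd.2.2 (X ⟨0, Nat.pos_of_ne_zero hn⟩) (totalDegree_X _) (dvd_zero _)

/-! ### Affine substitutions and the rank of first derivatives. -/

/-- The linear part of an affine substitution. -/
def linPart (u : Fin n → MvPolynomial (Fin n) F) : (Fin n → F) →ₗ[F] (Fin n → F) where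
  toFun v i := ∑ j, linCoeff (u i) j * v j
  map_add' v w := by ext k; simp [mul_add, Finset.sum_add_distrib]
  map_smul' c v := by
    ext k
    simp only [Pi.smul_apply, smul_eq_mul, RingHom.id_apply, Finset.mul_sum]
    exact Finset.sum_congr rfl fun j _ => by ring

lemma formalShift_bind₁ {u : Fin n → MvPolynomial (Fin n) F} (hu : ∀ i, (u i).totalDegree ≤ 1)
    (v : Fin n → F) (g : MvPolynomial (Fin n) F) :
    formalShift v (bind₁ u g) = (formalShift (linPart u v) g).map (bind₁ u).toRingHom := by
  have := MvPolynomial.ringHom_ext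
    (f := ((formalShift v).toRingHom).comp (bind₁ u).toRingHom)
    (g := (Polynomial.mapRingHom (bind₁ u).toRingHom).comp
      (formalShift (linPart u v)).toRingHom)
    (fun r => by simp [Polynomial.algebraMap_apply])
    (fun i => by
      simp only [RingHom.comp_apply, AlgHom.toRingHom_eq_coe, RingHom.coe_coe, bind₁_X_right,
        formalShift_X, Polynomial.coe_mapRingHom, Polynomial.map_add, Polynomial.map_mul,
        Polynomial.map_C, Polynomial.map_X, formalShift_of_totalDegree_le_one (hu i)]
      simp [linPart])
  exact congrArg (fun φ : MvPolynomial (Fin n) F →+* _ => φ g) this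

/-- The common kernel of the directional derivatives of a set of polynomials. -/
def derivSpace (G : Set (MvPolynomial (Fin n) F)) : Submodule F (Fin n → F) where
  carrier := {v | ∀ g ∈ G, ∑ i, C (v i) * pderiv i g = 0}
  zero_mem' := fun g _ => by simp
  add_mem' := fun {v w} hv hw g hg => by
    simp only [Pi.add_apply, map_add, add_mul, Finset.sum_add_distrib, hv g hg, hw g hg, add_zero]
  smul_mem' := fun c v hv g hg => by
    simp only [Pi.smul_apply, smul_eq_mul, map_mul, mul_assoc, ← Finset.mul_sum, hv g hg, mul_zero]

lemma mem_derivSpace {G : Set (MvPolynomial (Fin n) F)} {v : Fin n → F} :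
    v ∈ derivSpace G ↔ ∀ g ∈ G, ∑ i, C (v i) * pderiv i g = 0 := Iff.rfl

lemma formalShift_coeff_one (v : Fin n → F) (g : MvPolynomial (Fin n) F) :
    (formalShift v g).coeff 1 = ∑ i, C (v i) * pderiv i g := by
  induction g using MvPolynomial.induction_on with
  | C c => simp [formalShift]
  | add p q hp hq => simp only [map_add, Polynomial.coeff_add, hp, hq, mul_add,
      Finset.sum_add_distrib]
  | mul_X p i hp =>
    rw [map_mul, Polynomial.mul_coeff_one, formalShift_coeff_zero, formalShift_coeff_zero, hp,
      formalShift_X]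
    simp only [Polynomial.coeff_add, Polynomial.coeff_C_mul, Polynomial.coeff_X_one, mul_one,
      pderiv_mul, mul_add, Finset.sum_add_distrib, Finset.sum_mul]
    rw [add_comm]
    congr 1
    · exact Finset.sum_congr rfl fun j _ => by ring
    · rw [Finset.sum_eq_single i]
      · simp
        ring
      · intro j _ hj
        rw [pderiv_X_of_ne hj.symm]
        simp
      · simp

lemma invSpace_le_derivSpace (G : Set (MvPolynomial (Fin n) F)) : invSpace G ≤ derivSpace G := by
  intro v hv g hg
  have h : formalShift v g = Polynomial.C g := hv g hg
  rw [← formalShift_coeff_one, h, Polynomial.coeff_C_succ]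

/-- The rank of the space of first derivatives of a set of polynomials. -/
def derivRank (G : Set (MvPolynomial (Fin n) F)) : ℕ :=
  Module.finrank F ((Fin n → F) ⧸ derivSpace G)

lemma derivRank_add_finrank (G : Set (MvPolynomial (Fin n) F)) :
    derivRank G + Module.finrank F (derivSpace G) = n := by
  simpa [derivRank] using Submodule.finrank_quotient_add_finrank (derivSpace G)

lemma finrank_quotient_le_of_comap_le {U W : Submodule F (Fin n → F)}
    (φ : (Fin n → F) →ₗ[F] (Fin n → F)) (h : W.comap φ ≤ U) :
    Module.finrank F ((Fin n → F) ⧸ U) ≤ Module.finrank F ((Fin n → F) ⧸ W) := by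
  have h1 := LinearMap.finrank_range_add_finrank_ker (W.mkQ.comp φ)
  have h2 : LinearMap.ker (W.mkQ.comp φ) = W.comap φ := by
    rw [LinearMap.ker_comp, Submodule.ker_mkQ]
  rw [h2] at h1
  have h3 := Submodule.finrank_le (LinearMap.range (W.mkQ.comp φ))
  have h4 := Submodule.finrank_mono h
  have h5 := Submodule.finrank_quotient_add_finrank U
  omega

lemma invCodim_image_bind₁_le {u : Fin n → MvPolynomial (Fin n) F}
    (hu : ∀ i, (u i).totalDegree ≤ 1) (G : Set (MvPolynomial (Fin n) F)) :
    invCodim (bind₁ u '' G) ≤ invCodim G := by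
  refine finrank_quotient_le_of_comap_le (linPart u) ?_
  rintro v hv _ ⟨g, hg, rfl⟩
  have : formalShift (linPart u v) g = Polynomial.C g := hv g hg
  rw [InvariantAlong, formalShift_bind₁ hu, this, Polynomial.map_C]
  rfl

lemma derivRank_image_bind₁_le {u : Fin n → MvPolynomial (Fin n) F}
    (hu : ∀ i, (u i).totalDegree ≤ 1) (G : Set (MvPolynomial (Fin n) F)) :
    derivRank (bind₁ u '' G) ≤ derivRank G := by
  refine finrank_quotient_le_of_comap_le (linPart u) ?_
  rintro v hv _ ⟨g, hg, rfl⟩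
  have : ∑ i, C (linPart u v i) * pderiv i g = 0 := hv g hg
  rw [← formalShift_coeff_one, formalShift_bind₁ hu, Polynomial.coeff_map, formalShift_coeff_one,
    this, map_zero]

/-! ### Restrictions and their directions of invariance. -/

/-- The restriction as an algebra homomorphism. -/
def restrictHom (S : Finset (Fin n)) (a : Fin n → F) :
    MvPolynomial (Fin n) F →ₐ[F] MvPolynomial (Fin n) F :=
  bind₁ fun j => if j ∈ S then X j else C (a j)

lemma restrictHom_X (S : Finset (Fin n)) (a : Fin n → F) (i : Fin n) :
    restrictHom S a (X i) = if i ∈ S then X i else C (a i) := by simp [restrictHom]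

lemma restrictHom_C (S : Finset (Fin n)) (a : Fin n → F) (c : F) :
    restrictHom S a (C c) = C c := by simp [restrictHom]

lemma restrictHom_restrictHom {B S : Finset (Fin n)} (h : B ⊆ S) (a : Fin n → F)
    (g : MvPolynomial (Fin n) F) : restrictHom B a (restrictHom S a g) = restrictHom B a g := by
  rw [← AlgHom.comp_apply]
  refine congrArg (fun φ : MvPolynomial (Fin n) F →ₐ[F] _ => φ g) ?_
  ext1 i
  rw [AlgHom.comp_apply, restrictHom_X]
  split_ifs with hi
  · rfl
  · rw [restrictHom_C, restrictHom_X, if_neg fun hB => hi (h hB)]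

lemma restrictHom_univ (a : Fin n → F) (g : MvPolynomial (Fin n) F) :
    restrictHom Finset.univ a g = g := by
  simp [restrictHom]

lemma eval_restrictHom (S : Finset (Fin n)) (a : Fin n → F) (g : MvPolynomial (Fin n) F) :
    eval a (restrictHom S a g) = eval a g := by
  have := MvPolynomial.ringHom_ext
    (f := (eval a).comp (restrictHom S a).toRingHom) (g := eval a)
    (fun r => by simp)
    (fun i => by
      simp only [RingHom.comp_apply, AlgHom.toRingHom_eq_coe, RingHom.coe_coe, restrictHom_X]
      split_ifs <;> simp)
  exact congrArg (fun φ : MvPolynomial (Fin n) F →+* _ => φ g) this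

lemma pderiv_restrictHom_of_mem {S : Finset (Fin n)} (a : Fin n → F) {i : Fin n} (hi : i ∈ S)
    (g : MvPolynomial (Fin n) F) :
    pderiv i (restrictHom S a g) = restrictHom S a (pderiv i g) := by
  classical
  induction g using MvPolynomial.induction_on with
  | C c => simp
  | add p q hp hq => simp only [map_add, hp, hq]
  | mul_X p j hp =>
    rw [map_mul, pderiv_mul, pderiv_mul, map_add, map_mul, map_mul, hp, restrictHom_X]
    congr 2
    split_ifs with hj
    · rw [pderiv_X, Pi.single_apply]
      split_ifs <;> simp
    · rw [pderiv_C, pderiv_X_of_ne (by rintro rfl; exact hj hi), map_zero]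

lemma vars_restrictHom (S : Finset (Fin n)) (a : Fin n → F) (g : MvPolynomial (Fin n) F) :
    (restrictHom S a g).vars ⊆ g.vars ∩ S := by
  classical
  intro i hi
  obtain ⟨j, hj, hij⟩ := mem_vars_bind₁ _ g hi
  split_ifs at hij with hS
  · rw [vars_X, Finset.mem_singleton] at hij
    subst hij
    exact Finset.mem_inter.2 ⟨hj, hS⟩
  · simp at hij

lemma pderiv_restrictHom_of_notMem {S : Finset (Fin n)} (a : Fin n → F) {i : Fin n} (hi : i ∉ S)
    (g : MvPolynomial (Fin n) F) : pderiv i (restrictHom S a g) = 0 :=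
  pderiv_eq_zero_of_notMem_vars fun h => hi (Finset.mem_inter.1 (vars_restrictHom S a g h)).2

/-- The restrictions of a set of polynomials. -/
def restrictSet (G : Set (MvPolynomial (Fin n) F)) (S : Finset (Fin n)) (a : Fin n → F) :
    Set (MvPolynomial (Fin n) F) :=
  restrictHom S a '' G

lemma restrictSet_univ (G : Set (MvPolynomial (Fin n) F)) (a : Fin n → F) :
    restrictSet G Finset.univ a = G := by
  simp [restrictSet, restrictHom_univ]

lemma coordSpace_le_invSpace_restrictSet (G : Set (MvPolynomial (Fin n) F))
    (S : Finset (Fin n)) (a : Fin n → F) : coordSpace Sᶜ ≤ invSpace (restrictSet G S a) := by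
  rintro v hv _ ⟨g, hg, rfl⟩
  refine invariantAlong_of_vars fun i hi => hv i ?_
  simpa using (Finset.mem_inter.1 (vars_restrictHom S a g hi)).2

lemma InvariantAlong.restrictHom {S : Finset (Fin n)} {v : Fin n → F}
    {g : MvPolynomial (Fin n) F} (h : InvariantAlong g v) (hv : v ∈ coordSpace S) (a : Fin n → F) :
    InvariantAlong (restrictHom S a g) v := by
  have h1 := h.aeval_eq (A := Polynomial (MvPolynomial (Fin n) F))
    (fun i => Polynomial.C (SemanticRank.restrictHom S a (X i))) Polynomial.X
  rw [InvariantAlong]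
  refine Eq.trans ?_ (h1.trans ?_)
  · rw [SemanticRank.restrictHom, bind₁, ← AlgHom.comp_apply]
    refine congrArg (fun φ : MvPolynomial (Fin n) F →ₐ[F] _ => φ g) ?_
    ext1 i
    simp only [AlgHom.comp_apply, aeval_X]
    split_ifs with hi
    · simp [formalShift_X, Polynomial.algebraMap_apply]
    · simp [hv i hi]
  · have := MvPolynomial.ringHom_ext
      (f := (aeval (fun i => Polynomial.C (SemanticRank.restrictHom S a (X i))) :
        MvPolynomial (Fin n) F →ₐ[F] Polynomial (MvPolynomial (Fin n) F)).toRingHom)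
      (g := Polynomial.C.comp (SemanticRank.restrictHom S a).toRingHom)
      (fun r => by simp [Polynomial.algebraMap_apply])
      (fun i => by simp)
    exact congrArg (fun φ : MvPolynomial (Fin n) F →+* _ => φ g) this

/-- A dimension count. A direction in `coordSpace B` invariant for the `S`-restriction stays
invariant for the `B`-restriction, so the intersection is no larger for `S` than for `B`. By `h` the
invariance space is at least as large, hence so is the sum, and for `B` the sum is already
everything. -/
lemma coordSpace_sup_invSpace_eq_top {G : Set (MvPolynomial (Fin n) F)} {B S : Finset (Fin n)}
    (hBS : B ⊆ S) {a : Fin n → F}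
    (h : invCodim (restrictSet G S a) ≤ invCodim (restrictSet G B a)) :
    coordSpace B ⊔ invSpace (restrictSet G S a) = ⊤ := by
  have h1 : coordSpace B ⊔ invSpace (restrictSet G B a) = ⊤ :=
    sup_eq_top_of_coordSpace_le le_rfl (coordSpace_le_invSpace_restrictSet G B a)
  have h2 : coordSpace B ⊓ invSpace (restrictSet G S a) ≤
      coordSpace B ⊓ invSpace (restrictSet G B a) := by
    refine le_inf inf_le_left ?_
    rintro v ⟨hv1, hv2⟩ _ ⟨g, hg, rfl⟩
    rw [← restrictHom_restrictHom hBS]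
    exact (hv2 _ ⟨g, hg, rfl⟩).restrictHom hv1 a
  have h3 := Submodule.finrank_mono h2
  have h4 := Submodule.finrank_sup_add_finrank_inf_eq (coordSpace B : Submodule F (Fin n → F))
    (invSpace (restrictSet G S a))
  have h5 := Submodule.finrank_sup_add_finrank_inf_eq (coordSpace B : Submodule F (Fin n → F))
    (invSpace (restrictSet G B a))
  have h6 := invCodim_add_finrank (restrictSet G S a)
  have h7 := invCodim_add_finrank (restrictSet G B a)
  rw [h1, finrank_top, Module.finrank_fintype_fun_eq_card, Fintype.card_fin] at h5
  apply Submodule.eq_top_of_finrank_eq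
  apply le_antisymm (Submodule.finrank_le _)
  rw [Module.finrank_fintype_fun_eq_card, Fintype.card_fin]
  omega

/-- If adding variables to a restriction does not raise the codimension of the invariance space,
then the larger restriction is an affine substitution of the smaller one. -/
lemma exists_affine_of_invCodim_le {G : Set (MvPolynomial (Fin n) F)} {B S : Finset (Fin n)}
    (hBS : B ⊆ S) {a : Fin n → F}
    (h : invCodim (restrictSet G S a) ≤ invCodim (restrictSet G B a)) :
    ∃ u : Fin n → MvPolynomial (Fin n) F, (∀ i, (u i).totalDegree ≤ 1) ∧
      restrictSet G S a = bind₁ u '' restrictSet G B a := by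
  have htop := coordSpace_sup_invSpace_eq_top hBS h
  have hdec : ∀ j : Fin n, ∃ b ∈ (coordSpace B : Submodule F (Fin n → F)),
      ∃ w ∈ invSpace (restrictSet G S a), b + w = Pi.single j 1 := by
    intro j
    have : (Pi.single j 1 : Fin n → F) ∈ coordSpace B ⊔ invSpace (restrictSet G S a) := by
      rw [htop]; trivial
    obtain ⟨y, hy, w, hw, hwy⟩ := Submodule.mem_sup.1 this
    exact ⟨y, hy, w, hw, hwy⟩
  choose b hb w hw hbw using hdec
  -- Each basis vector is `b j + w j` with `b j` supported on `B` and `w j` invariant. The map `u`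
  -- projects onto the `b` part with base point `a'`: outside `B` its coordinates equal those of
  -- `a`, so substituting `u` has the effect of restricting to `B` first, while invariance along the
  -- `w j` leaves the `S`-restriction unchanged.
  let a' : Fin n → F := fun i => if i ∈ B then 0 else a i
  let u : Fin n → MvPolynomial (Fin n) F := fun i => C (a' i) + ∑ j, C (b j i) * (X j - C (a' j))
  have hu1 : ∀ i, (u i).totalDegree ≤ 1 := by
    intro i
    refine (totalDegree_add _ _).trans (max_le (by simp) ?_)
    refine totalDegree_finsetSum_le fun j _ => (totalDegree_mul _ _).trans ?_
    rw [totalDegree_C, zero_add]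
    exact (totalDegree_sub _ _).trans (by simp)
  refine ⟨u, hu1, ?_⟩
  have key : ∀ g ∈ G, restrictHom S a g = bind₁ u (restrictHom B a g) := by
    intro g hg
    have h1 := aeval_add_sum_eq (A := MvPolynomial (Fin n) F) Finset.univ w
      (fun j _ => hw j _ ⟨g, hg, rfl⟩) u (fun j => X j - C (a' j))
    have h2 : (fun i => u i + ∑ j, algebraMap F (MvPolynomial (Fin n) F) (w j i) *
        (X j - C (a' j))) = X := by
      funext i
      have : ∀ j, C (b j i) * (X j - C (a' j)) + algebraMap F (MvPolynomial (Fin n) F) (w j i) *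
          (X j - C (a' j)) = C ((Pi.single j 1 : Fin n → F) i) * (X j - C (a' j)) := by
        intro j
        rw [← hbw j, Pi.add_apply, map_add, MvPolynomial.algebraMap_eq]
        ring
      simp only [u]
      rw [add_assoc, ← Finset.sum_add_distrib, Finset.sum_congr rfl fun j _ => this j,
        Finset.sum_eq_single i]
      · simp
      · intro j _ hj
        simp [Ne.symm hj]
      · simp
    rw [h2] at h1
    have h3 : aeval (X : Fin n → MvPolynomial (Fin n) F) (restrictHom S a g) =
        restrictHom S a g := by simp
    rw [h3] at h1
    have h4 : (aeval u).comp (restrictHom B a) =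
        (aeval u : MvPolynomial (Fin n) F →ₐ[F] MvPolynomial (Fin n) F) := by
      ext1 i
      rw [AlgHom.comp_apply, restrictHom_X, aeval_X]
      split_ifs with hi
      · rw [aeval_X]
      · have hz : ∀ j, b j i = 0 := fun j => hb j i hi
        simp [u, a', hi, hz]
    rw [h1, ← restrictHom_restrictHom hBS, bind₁]
    exact (congrArg (fun φ : MvPolynomial (Fin n) F →ₐ[F] MvPolynomial (Fin n) F =>
      φ (restrictHom S a g)) h4).symm
  ext p
  simp only [restrictSet, Set.mem_image, exists_exists_and_eq_and]
  constructor
  · rintro ⟨g, hg, rfl⟩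
    exact ⟨g, hg, (key g hg).symm⟩
  · rintro ⟨g, hg, rfl⟩
    exact ⟨g, hg, key g hg⟩

/-! ### Generic independence of derivatives and its certifying minors. -/

/-- Independent rows, even with infinitely many columns, have a nonzero maximal minor. It turns
generic independence into the nonvanishing of one polynomial at `a`. -/
lemma exists_det_ne_zero {R J I : Type*} [CommRing R] [IsDomain R] [Fintype J] [DecidableEq J]
    {u : J → I → R} (hu : LinearIndependent R u) :
    ∃ f : J → I, (Matrix.of fun j k => u j (f k)).det ≠ 0 := by
  classical
  let K := FractionRing R
  let ψ : (I → R) →ₗ[R] (I → K) := LinearMap.compLeft (Algebra.linearMap R K) I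
  have hψ : LinearMap.ker ψ = ⊥ := by
    rw [LinearMap.ker_eq_bot]
    intro x y hxy
    funext i
    exact IsFractionRing.injective R K (congrFun hxy i)
  have hK : LinearIndependent K (ψ ∘ u) :=
    (LinearIndependent.iff_fractionRing R K).1 (hu.map' ψ hψ)
  let w : I → J → K := fun i j => algebraMap R K (u j i)
  -- A functional that kills all columns is a linear relation between the rows, so the columns span
  -- and contain a basis.
  have hspan : Submodule.span K (Set.range w) = ⊤ := by
    by_contra hne
    obtain ⟨φ, hφ0, hφ⟩ := Submodule.exists_le_ker_of_lt_top _ (lt_top_iff_ne_top.2 hne)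
    apply hφ0
    have h0 : ∀ j, φ (Pi.single j 1) = 0 := by
      rw [Fintype.linearIndependent_iff] at hK
      refine hK _ ?_
      funext i
      have h1 : φ (w i) = 0 := hφ (Submodule.subset_span ⟨i, rfl⟩)
      rw [LinearMap.pi_apply_eq_sum_univ φ (w i)] at h1
      rw [Pi.zero_apply, ← h1, Finset.sum_apply]
      refine Finset.sum_congr rfl fun j _ => ?_
      have : (fun k => if j = k then (1 : K) else 0) = Pi.single j 1 := by
        funext k
        simp [Pi.single_apply, eq_comm]
      rw [this, Pi.smul_apply, smul_eq_mul, smul_eq_mul, mul_comm]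
      rfl
    ext j
    simp [h0]
  obtain ⟨b, hb, -, hli⟩ := Submodule.exists_fun_fin_finrank_span_eq K (Set.range w)
  choose f hf using hb
  let e : J ≃ Fin (Module.finrank K (Submodule.span K (Set.range w))) :=
    Fintype.equivFinOfCardEq (by
      rw [hspan, finrank_top, Module.finrank_fintype_fun_eq_card])
  refine ⟨fun j => f (e j), ?_⟩
  have h1 : LinearIndependent K (fun j => w (f (e j))) := by
    have : (fun j => w (f (e j))) = b ∘ e := by
      funext j
      exact hf (e j)
    rw [this]
    exact hli.comp _ e.injective
  have h2 := (Matrix.linearIndependent_rows_iff_isUnit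
    (A := (Matrix.of fun j k => w (f (e j)) k))).1 h1
  rw [Matrix.isUnit_iff_isUnit_det, isUnit_iff_ne_zero] at h2
  intro h3
  apply h2
  rw [← Matrix.det_transpose]
  have h4 : (Matrix.of fun j k => w (f (e j)) k).transpose =
      (algebraMap R K).mapMatrix (Matrix.of fun j k => u j (f (e k))) := by
    ext j k
    simp [w]
  rw [h4, ← RingHom.map_det, h3, map_zero]

/-- The polynomial `g` with the variables outside `S` moved to the coefficients. -/
def splitHom (S : Finset (Fin n)) :
    MvPolynomial (Fin n) F →ₐ[F] MvPolynomial (Fin n) (MvPolynomial (Fin n) F) :=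
  aeval fun j => if j ∈ S then X j else C (X j)

lemma splitHom_X (S : Finset (Fin n)) (i : Fin n) :
    splitHom S (X i : MvPolynomial (Fin n) F) = if i ∈ S then X i else C (X i) := by
  simp [splitHom]

lemma splitHom_C (S : Finset (Fin n)) (c : F) :
    splitHom S (C c : MvPolynomial (Fin n) F) = C (C c) := by
  simp [splitHom, MvPolynomial.algebraMap_apply]

lemma map_eval_splitHom (S : Finset (Fin n)) (a : Fin n → F) (g : MvPolynomial (Fin n) F) :
    map (eval a) (splitHom S g) = restrictHom S a g := by
  have := MvPolynomial.ringHom_ext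
    (f := (map (eval a)).comp (splitHom S).toRingHom) (g := (restrictHom S a).toRingHom)
    (fun r => by simp [MvPolynomial.algebraMap_apply])
    (fun i => by
      simp only [RingHom.comp_apply, AlgHom.toRingHom_eq_coe, RingHom.coe_coe, restrictHom_X,
        splitHom_X]
      split_ifs <;> simp)
  exact congrArg (fun φ : MvPolynomial (Fin n) F →+* _ => φ g) this

lemma eval_X_splitHom (S : Finset (Fin n)) (g : MvPolynomial (Fin n) F) :
    eval X (splitHom S g) = g := by
  have := MvPolynomial.ringHom_ext
    (f := (eval X).comp (splitHom S).toRingHom) (g := RingHom.id (MvPolynomial (Fin n) F))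
    (fun r => by simp [MvPolynomial.algebraMap_apply])
    (fun i => by
      simp only [RingHom.comp_apply, AlgHom.toRingHom_eq_coe, RingHom.coe_coe, splitHom_X]
      split_ifs <;> simp)
  exact congrArg (fun φ : MvPolynomial (Fin n) F →+* _ => φ g) this

lemma splitHom_injective (S : Finset (Fin n)) :
    Function.Injective (splitHom S : MvPolynomial (Fin n) F → _) :=
  Function.LeftInverse.injective (g := eval X) (eval_X_splitHom S)

lemma splitHom_monomial (S : Finset (Fin n)) (s : Fin n →₀ ℕ) (c : F) :
    splitHom S (monomial s c) =
      monomial (s.filter (· ∈ S)) (monomial (s.filter (· ∉ S)) c) := by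
  classical
  induction s using Finsupp.induction_linear generalizing c with
  | zero =>
    rw [Finsupp.filter_zero, Finsupp.filter_zero]
    exact splitHom_C S c
  | add s t hs ht =>
    have h1 : monomial (s + t) c = monomial s c * monomial t (1 : F) := by
      rw [monomial_mul, mul_one]
    rw [h1, map_mul, hs, ht, monomial_mul, monomial_mul, mul_one, Finsupp.filter_add,
      Finsupp.filter_add]
  | single i k =>
    have h1 : monomial (Finsupp.single i k) c = C c * X i ^ k := by
      rw [C_mul_X_pow_eq_monomial]
    rw [h1, map_mul, map_pow, splitHom_X, splitHom_C]
    split_ifs with hi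
    · rw [Finsupp.filter_single_of_pos _ hi, Finsupp.filter_single_of_neg _ (by simpa using hi),
        C_mul_X_pow_eq_monomial]
      rfl
    · rw [Finsupp.filter_single_of_pos (· ∉ S) hi, Finsupp.filter_single_of_neg _ hi,
        ← C_mul_X_pow_eq_monomial, ← map_pow, ← map_mul]
      rfl

lemma totalDegree_coeff_splitHom_le (S : Finset (Fin n)) (g : MvPolynomial (Fin n) F)
    (m : Fin n →₀ ℕ) : (coeff m (splitHom S g)).totalDegree ≤ g.totalDegree := by
  classical
  conv_lhs => rw [g.as_sum, map_sum, coeff_sum]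
  refine totalDegree_finsetSum_le fun s hs => ?_
  rw [splitHom_monomial, coeff_monomial]
  split_ifs with h
  · refine (totalDegree_monomial_le _ _).trans (le_trans ?_ (le_totalDegree hs))
    change (s.filter (· ∉ S)).degree ≤ s.degree
    have := congrArg Finsupp.degree (Finsupp.filter_add_filter_not s (· ∈ S))
    rw [map_add] at this
    omega
  · simp

lemma map_splitHom_splitHom {S T : Finset (Fin n)} (h : T ⊆ S) (g : MvPolynomial (Fin n) F) :
    map (splitHom T).toRingHom (splitHom S g) = map C (splitHom S g) := by
  have := MvPolynomial.ringHom_ext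
    (f := (map (splitHom T).toRingHom).comp (splitHom S : MvPolynomial (Fin n) F →ₐ[F] _).toRingHom)
    (g := (map C).comp (splitHom S : MvPolynomial (Fin n) F →ₐ[F] _).toRingHom)
    (fun r => by simp [MvPolynomial.algebraMap_apply])
    (fun i => by
      simp only [RingHom.comp_apply, AlgHom.toRingHom_eq_coe, RingHom.coe_coe, splitHom_X]
      split_ifs with hi
      · simp
      · simp [splitHom_X, show i ∉ T from fun hT => hi (h hT)])
  exact congrArg (fun φ : MvPolynomial (Fin n) F →+* _ => φ g) this

lemma splitHom_coeff_splitHom {S T : Finset (Fin n)} (h : T ⊆ S) (g : MvPolynomial (Fin n) F)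
    (m : Fin n →₀ ℕ) : splitHom T (coeff m (splitHom S g)) = C (coeff m (splitHom S g)) := by
  have := congrArg (coeff m) (map_splitHom_splitHom h g)
  rwa [coeff_map, coeff_map] at this

/-- Moving the variables outside `S` to the coefficients. -/
def moveHom (S : Finset (Fin n)) : MvPolynomial (Fin n) (MvPolynomial (Fin n) F) →ₐ[MvPolynomial
    (Fin n) F] MvPolynomial (Fin n) (MvPolynomial (Fin n) F) :=
  aeval fun j => if j ∈ S then X j else C (X j)

lemma moveHom_splitHom {S T : Finset (Fin n)} (h : T ⊆ S) (g : MvPolynomial (Fin n) F) :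
    moveHom T (splitHom S g) = splitHom T g := by
  have := MvPolynomial.ringHom_ext
    (f := (moveHom T).toRingHom.comp (splitHom S : MvPolynomial (Fin n) F →ₐ[F] _).toRingHom)
    (g := (splitHom T : MvPolynomial (Fin n) F →ₐ[F] _).toRingHom)
    (fun r => by simp [MvPolynomial.algebraMap_apply, moveHom])
    (fun i => by
      simp only [RingHom.comp_apply, AlgHom.toRingHom_eq_coe, RingHom.coe_coe, splitHom_X, moveHom]
      split_ifs with hi hT hT
      · simp [hT]
      · simp [hT]
      · exact absurd (h hT) hi
      · simp)
  exact congrArg (fun φ : MvPolynomial (Fin n) F →+* _ => φ g) this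

/-- The vectors of first derivatives, split with respect to `S`. -/
def splitDeriv (G : Set (MvPolynomial (Fin n) F)) (S : Finset (Fin n)) (i : Fin n) :
    G → MvPolynomial (Fin n) (MvPolynomial (Fin n) F) :=
  fun g => splitHom S (pderiv i g.1)

/-- The first derivatives with indices in `J` are independent over the polynomials in the
variables outside `S`. -/
def GenericIndep (G : Set (MvPolynomial (Fin n) F)) (S J : Finset (Fin n)) : Prop :=
  LinearIndependent (MvPolynomial (Fin n) F) fun j : J => splitDeriv G S j

/-- A relation over the coefficient ring survives moving further variables into the coefficients,
because `moveHom T` is linear over that ring. -/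
lemma GenericIndep.mono {G : Set (MvPolynomial (Fin n) F)} {S T J : Finset (Fin n)}
    (h : GenericIndep G T J) (hTS : T ⊆ S) : GenericIndep G S J := by
  refine LinearIndependent.of_comp (LinearMap.compLeft (moveHom T).toLinearMap G) ?_
  have h1 : (LinearMap.compLeft (moveHom T).toLinearMap G ∘ fun j : J => splitDeriv G S j) =
      fun j : J => splitDeriv G T j := by
    funext j g
    exact moveHom_splitHom hTS _
  rw [h1]
  exact h

/-- The coordinates of a family of polynomials. -/
def coeffMap (A ι : Type*) [CommRing A] :
    (ι → MvPolynomial (Fin n) A) →ₗ[A] (ι × (Fin n →₀ ℕ) → A) where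
  toFun v x := coeff x.2 (v x.1)
  map_add' _ _ := by ext; simp
  map_smul' _ _ := by ext; simp

lemma ker_coeffMap (A ι : Type*) [CommRing A] :
    LinearMap.ker (coeffMap (n := n) A ι) = ⊥ := by
  rw [LinearMap.ker_eq_bot]
  intro v w h
  funext i
  ext m
  exact congrFun h (i, m)

/-- The vectors of first derivatives, restricted to `S` at `a`. -/
def restrictDeriv (G : Set (MvPolynomial (Fin n) F)) (S : Finset (Fin n)) (a : Fin n → F)
    (i : Fin n) : G → MvPolynomial (Fin n) F :=
  fun g => restrictHom S a (pderiv i g.1)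

lemma eval_coeffMap_splitDeriv (G : Set (MvPolynomial (Fin n) F)) (S : Finset (Fin n))
    (a : Fin n → F) (i : Fin n) (x : G × (Fin n →₀ ℕ)) :
    eval a (coeffMap _ G (splitDeriv G S i) x) = coeffMap _ G (restrictDeriv G S a i) x := by
  simp only [coeffMap, LinearMap.coe_mk, AddHom.coe_mk, splitDeriv, restrictDeriv]
  rw [← map_eval_splitHom, coeff_map]

lemma eval_det_splitDeriv {G : Set (MvPolynomial (Fin n) F)} {S J : Finset (Fin n)}
    (a : Fin n → F) (f : J → G × (Fin n →₀ ℕ)) :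
    eval a (Matrix.of fun j k : J => coeffMap _ G (splitDeriv G S j) (f k)).det =
      (Matrix.of fun j k : J => coeffMap _ G (restrictDeriv G S a j) (f k)).det := by
  rw [RingHom.map_det]
  congr 1
  ext j k
  exact eval_coeffMap_splitDeriv G S a j (f k)

lemma linearIndependent_of_det_coeffMap {A : Type*} [CommRing A] [IsDomain A] {ι J : Type*}
    [Fintype J] [DecidableEq J] {v : J → ι → MvPolynomial (Fin n) A}
    {f : J → ι × (Fin n →₀ ℕ)} (h : (Matrix.of fun j k => coeffMap A ι (v j) (f k)).det ≠ 0) :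
    LinearIndependent A v := by
  have h1 := Matrix.linearIndependent_rows_of_det_ne_zero h
  refine LinearIndependent.of_comp ((LinearMap.funLeft A A f).comp (coeffMap A ι)) ?_
  exact h1

/-- A minor that is nonzero after specialization at `a` is nonzero as a polynomial. Hence the
derivative rank of a restriction never exceeds the generic one, whatever `a` is. -/
lemma GenericIndep.of_restrict {G : Set (MvPolynomial (Fin n) F)} {S J : Finset (Fin n)}
    {a : Fin n → F} (h : LinearIndependent F fun j : J => restrictDeriv G S a j) :
    GenericIndep G S J := by
  obtain ⟨f, hf⟩ := exists_det_ne_zero (h.map' (coeffMap F G) (ker_coeffMap F G))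
  refine linearIndependent_of_det_coeffMap (f := f) ?_
  intro h0
  have := eval_det_splitDeriv (S := S) a f
  rw [h0, map_zero] at this
  exact hf this.symm

lemma totalDegree_pderiv_le (i : Fin n) (g : MvPolynomial (Fin n) F) :
    (pderiv i g).totalDegree ≤ g.totalDegree := by
  classical
  conv_lhs => rw [g.as_sum, map_sum]
  refine totalDegree_finsetSum_le fun s hs => ?_
  rw [pderiv_monomial]
  refine (totalDegree_monomial_le _ _).trans (le_trans ?_ (le_totalDegree hs))
  change (s - Finsupp.single i 1).degree ≤ s.degree
  exact Finsupp.degree_mono tsub_le_self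

/-- The minor has at most `n` rows, with entries that are coefficients of derivatives and so of
degree at most `d`. -/
lemma GenericIndep.exists_minor {G : Set (MvPolynomial (Fin n) F)} {S J : Finset (Fin n)} {d : ℕ}
    (h : GenericIndep G S J) (hd : ∀ g ∈ G, totalDegree g ≤ d) :
    ∃ Δ : MvPolynomial (Fin n) F, Δ ≠ 0 ∧ Δ.totalDegree ≤ n * d ∧ ∀ a, eval a Δ ≠ 0 →
      LinearIndependent F fun j : J => restrictDeriv G S a j := by
  obtain ⟨f, hf⟩ := exists_det_ne_zero (h.map' (coeffMap _ G) (ker_coeffMap _ G))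
  refine ⟨_, hf, ?_, fun a ha => ?_⟩
  · rw [Matrix.det_apply]
    refine totalDegree_finsetSum_le fun σ _ => ?_
    refine (totalDegree_smul_le _ _).trans ((totalDegree_finsetProd _ _).trans ?_)
    have hcard : Fintype.card J ≤ n := by
      simpa using Finset.card_le_univ J
    refine (Finset.sum_le_card_nsmul _ _ d fun j _ => ?_).trans ?_
    · exact (totalDegree_coeff_splitHom_le _ _ _).trans
        ((totalDegree_pderiv_le _ _).trans (hd _ (f j).1.2))
    · rw [smul_eq_mul]
      exact Nat.mul_le_mul_right d hcard
  · exact linearIndependent_of_det_coeffMap (f := f) (by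
      have := eval_det_splitDeriv (S := S) a f
      rw [← this]
      exact ha)

lemma genericIndep_iff {G : Set (MvPolynomial (Fin n) F)} {S J : Finset (Fin n)} :
    GenericIndep G S J ↔ ∀ c : Fin n → MvPolynomial (Fin n) F,
      (∀ g ∈ G, ∑ i ∈ J, C (c i) * splitHom S (pderiv i g) = 0) → ∀ i ∈ J, c i = 0 := by
  have h1 : GenericIndep G S J ↔
      LinearIndepOn (MvPolynomial (Fin n) F) (splitDeriv G S) (J : Set (Fin n)) := Iff.rfl
  rw [h1, linearIndepOn_finset_iff]
  refine forall_congr' fun c => imp_congr_left ?_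
  rw [funext_iff]
  simp [splitDeriv, smul_eq_C_mul]

/-! ### Relations between derivatives with constant coefficients. -/

lemma exists_relation {G : Set (MvPolynomial (Fin n) F)} {S J : Finset (Fin n)} {j : Fin n}
    (h : GenericIndep G S J) (hj : j ∉ J) (hnot : ¬ GenericIndep G S (insert j J)) :
    ∃ q : MvPolynomial (Fin n) F, q ≠ 0 ∧ ∃ c : Fin n → MvPolynomial (Fin n) F,
      ∀ g ∈ G, C q * splitHom S (pderiv j g) = ∑ i ∈ J, C (c i) * splitHom S (pderiv i g) := by
  rw [genericIndep_iff] at hnot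
  push Not at hnot
  obtain ⟨c, hc, i, hi, hci⟩ := hnot
  refine ⟨c j, ?_, fun k => - c k, fun g hg => ?_⟩
  · intro h0
    apply hci
    rcases Finset.mem_insert.1 hi with rfl | hi
    · exact h0
    · refine genericIndep_iff.1 h c (fun g hg => ?_) i hi
      have := hc g hg
      rwa [Finset.sum_insert hj, h0, map_zero, zero_mul, zero_add] at this
  · have := hc g hg
    rw [Finset.sum_insert hj] at this
    rw [eq_neg_of_add_eq_zero_left this, ← Finset.sum_neg_distrib]
    refine Finset.sum_congr rfl fun k _ => ?_
    rw [map_neg]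
    ring

lemma notMem_vars_of_splitHom_eq_C {z : Fin n} {q : MvPolynomial (Fin n) F}
    (h : splitHom {z} q = C q) : z ∉ q.vars := by
  have h1 : eval (0 : Fin n → MvPolynomial (Fin n) F) (splitHom {z} q) =
      restrictHom {z}ᶜ 0 q := by
    have := MvPolynomial.ringHom_ext
      (f := (eval (0 : Fin n → MvPolynomial (Fin n) F)).comp
        (splitHom {z} : MvPolynomial (Fin n) F →ₐ[F] _).toRingHom)
      (g := (restrictHom ({z}ᶜ : Finset (Fin n)) (0 : Fin n → F)).toRingHom)
      (fun r => by simp [MvPolynomial.algebraMap_apply])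
      (fun i => by
        simp only [RingHom.comp_apply, AlgHom.toRingHom_eq_coe, RingHom.coe_coe, splitHom_X,
          restrictHom_X]
        by_cases hi : i = z <;> simp [hi])
    exact congrArg (fun φ : MvPolynomial (Fin n) F →+* _ => φ q) this
  rw [h, eval_C] at h1
  rw [h1]
  intro hz
  simpa using (Finset.mem_inter.1 (vars_restrictHom _ _ _ hz)).2

/-- As `z ∈ S`, the coefficients of the split derivatives are free of `z`. So each power of `z` in
the relation's own coefficients gives a relation by itself; one is chosen at which `q` has a nonzero
coefficient. -/
lemma exists_relation_notMem_vars {G : Set (MvPolynomial (Fin n) F)} {S J : Finset (Fin n)}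
    {j z : Fin n} (hz : z ∈ S) (h : GenericIndep G S J) (hj : j ∉ J)
    (hnot : ¬ GenericIndep G S (insert j J)) :
    ∃ q : MvPolynomial (Fin n) F, q ≠ 0 ∧ z ∉ q.vars ∧ ∃ c : Fin n → MvPolynomial (Fin n) F,
      (∀ i, z ∉ (c i).vars) ∧
      ∀ g ∈ G, C q * splitHom S (pderiv j g) = ∑ i ∈ J, C (c i) * splitHom S (pderiv i g) := by
  obtain ⟨q, hq, c, hc⟩ := exists_relation h hj hnot
  have hzS : ({z} : Finset (Fin n)) ⊆ S := by simpa using hz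
  have hne : splitHom {z} q ≠ 0 := by
    rw [Ne, ← map_zero (splitHom {z})]
    exact fun h0 => hq (splitHom_injective _ h0)
  obtain ⟨k, hk⟩ := ne_zero_iff.1 hne
  refine ⟨coeff k (splitHom {z} q), hk, ?_, fun i => coeff k (splitHom {z} (c i)), fun i => ?_,
    fun g hg => ?_⟩
  · exact notMem_vars_of_splitHom_eq_C (splitHom_coeff_splitHom subset_rfl _ _)
  · exact notMem_vars_of_splitHom_eq_C (splitHom_coeff_splitHom subset_rfl _ _)
  · ext1 m
    have h1 := congrArg (coeff m) (hc g hg)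
    rw [coeff_C_mul, coeff_sum] at h1 ⊢
    simp only [coeff_C_mul] at h1 ⊢
    have h2 := congrArg (fun p => coeff k (splitHom {z} p)) h1
    have hmul : ∀ (p : MvPolynomial (Fin n) (MvPolynomial (Fin n) F)) (r),
        coeff k (p * C r) = coeff k p * r := fun p r => by
      rw [mul_comm, coeff_C_mul, mul_comm]
    simpa only [map_mul, map_sum, splitHom_coeff_splitHom hzS, hmul, coeff_sum] using h2

lemma relation_mono {G : Set (MvPolynomial (Fin n) F)} {S T J : Finset (Fin n)} {j : Fin n}
    (hTS : T ⊆ S) {q : MvPolynomial (Fin n) F} {c : Fin n → MvPolynomial (Fin n) F}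
    (h : ∀ g ∈ G, C q * splitHom S (pderiv j g) = ∑ i ∈ J, C (c i) * splitHom S (pderiv i g)) :
    ∀ g ∈ G, C q * splitHom T (pderiv j g) = ∑ i ∈ J, C (c i) * splitHom T (pderiv i g) := by
  intro g hg
  have := congrArg (moveHom T) (h g hg)
  simpa only [map_mul, map_sum, moveHom_splitHom hTS, ← MvPolynomial.algebraMap_eq,
    AlgHom.commutes] using this

lemma exists_C_of_vars_eq_empty {q : MvPolynomial (Fin n) F} (h : ∀ z, z ∉ q.vars) :
    ∃ α, q = C α :=
  ⟨_, vars_eq_empty_iff_eq_C.1 (Finset.eq_empty_of_forall_notMem h)⟩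

/-- If the derivative with index `j` depends on those with indices in `J` after adding any
variable to `B`, then it depends on them with constant coefficients. -/
lemma exists_constant_relation {G : Set (MvPolynomial (Fin n) F)} {B J : Finset (Fin n)}
    {j : Fin n} (h : GenericIndep G B J) (hj : j ∉ J)
    (hnot : ∀ z, ¬ GenericIndep G (insert z (insert j B)) (insert j J)) :
    ∃ γ : Fin n → F, ∀ g ∈ G, pderiv j g = ∑ i ∈ J, C (γ i) * pderiv i g := by
  have hsub : ∀ z, B ⊆ insert z (insert j B) := fun z =>
    (Finset.subset_insert _ _).trans (Finset.subset_insert _ _)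
  have hrel : ∀ z, ∃ q : MvPolynomial (Fin n) F, q ≠ 0 ∧ z ∉ q.vars ∧
      ∃ c : Fin n → MvPolynomial (Fin n) F, (∀ i, z ∉ (c i).vars) ∧
      ∀ g ∈ G, C q * splitHom B (pderiv j g) = ∑ i ∈ J, C (c i) * splitHom B (pderiv i g) := by
    intro z
    obtain ⟨q, hq, hqz, c, hcz, hc⟩ := exists_relation_notMem_vars
      (Finset.mem_insert_self z (insert j B)) (h.mono (hsub z)) hj (hnot z)
    exact ⟨q, hq, hqz, c, hcz, relation_mono (hsub z) hc⟩
  -- The index `j` is an arbitrary choice of `z`: any single relation serves as the reference for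
  -- the others.
  obtain ⟨Q, hQ, -, P, -, hQP⟩ := hrel j
  have hγ : ∀ i, ∃ γ : F, i ∈ J → P i = C γ * Q := by
    intro i
    by_cases hi : i ∈ J
    swap
    · exact ⟨0, fun h => absurd h hi⟩
    obtain ⟨q₀, p₀, r, hrel₀, hq₀, hp₀⟩ :=
      UniqueFactorizationMonoid.exists_reduced_factors Q hQ (P i)
    have hr : r ≠ 0 := by
      rintro rfl
      exact hQ (by rw [← hq₀, zero_mul])
    have hfree : ∀ z, z ∉ q₀.vars ∧ z ∉ p₀.vars := by
      intro z
      obtain ⟨q, hq, hqz, c, hcz, hc⟩ := hrel z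
      -- Independence on `B` determines the relation up to scaling, so `P i / Q = c i / q`. In
      -- lowest terms, numerator and denominator divide the `z`-free `c i` and `q` (or the numerator
      -- is `0`), so neither contains `z`. As `z` is arbitrary, both are constants.
      have hcross : q * P i = Q * c i := by
        have := genericIndep_iff.1 h (fun i => q * P i - Q * c i) (fun g hg => ?_) i hi
        · exact sub_eq_zero.1 this
        · simp only [map_sub, map_mul, sub_mul, Finset.sum_sub_distrib, mul_assoc,
            ← Finset.mul_sum]
          rw [← hQP g hg, ← hc g hg]
          ring
      have h1 : q * p₀ = q₀ * c i := by
        apply mul_left_cancel₀ hr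
        rw [← hq₀, ← hp₀] at hcross
        linear_combination hcross
      have h2 : q₀ ∣ q := hrel₀.dvd_of_dvd_mul_right ⟨c i, h1⟩
      refine ⟨fun hz => hqz (vars_subset_of_dvd hq h2 hz), fun hz => ?_⟩
      by_cases hci : c i = 0
      · rw [hci, mul_zero, mul_eq_zero] at h1
        rw [h1.resolve_left hq, vars_0] at hz
        simp at hz
      · have h3 : p₀ ∣ c i := hrel₀.symm.dvd_of_dvd_mul_left ⟨q, by rw [← h1, mul_comm]⟩
        exact hcz i (vars_subset_of_dvd hci h3 hz)
    obtain ⟨α, rfl⟩ := exists_C_of_vars_eq_empty fun z => (hfree z).1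
    obtain ⟨β, rfl⟩ := exists_C_of_vars_eq_empty fun z => (hfree z).2
    have hα : α ≠ 0 := by
      rintro rfl
      exact hQ (by rw [← hq₀, map_zero, mul_zero])
    refine ⟨β / α, fun _ => ?_⟩
    rw [← hq₀, ← hp₀, mul_left_comm, ← map_mul, div_mul_cancel₀ _ hα]
  choose γ hγ using hγ
  refine ⟨γ, fun g hg => mul_left_cancel₀ hQ ?_⟩
  have h1 := congrArg (eval X) (hQP g hg)
  simp only [map_mul, map_sum, eval_C, eval_X_splitHom] at h1
  rw [h1, Finset.mul_sum]
  refine Finset.sum_congr rfl fun i hi => ?_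
  rw [hγ i hi]
  ring

/-! ### The shear that removes derivatives outside `J`. -/

/-- The shear `x_i ↦ x_i - ∑ γ_{ji} y_j`, for `i ∈ J` and `j ∉ J`. -/
def shear (J : Finset (Fin n)) (γ : Fin n → Fin n → F) (y : Fin n → MvPolynomial (Fin n) F)
    (i : Fin n) : MvPolynomial (Fin n) F :=
  if i ∈ J then X i - ∑ j ∈ Jᶜ, C (γ j i) * y j else X i

lemma totalDegree_shear_le {J : Finset (Fin n)} {γ : Fin n → Fin n → F}
    {y : Fin n → MvPolynomial (Fin n) F} (hy : ∀ j, (y j).totalDegree ≤ 1) (i : Fin n) :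
    (shear J γ y i).totalDegree ≤ 1 := by
  rw [shear]
  split_ifs
  · refine (totalDegree_sub _ _).trans (max_le (by simp) ?_)
    refine totalDegree_finsetSum_le fun j _ => (totalDegree_mul _ _).trans ?_
    simpa using hy j
  · simp

lemma bind₁_shear_shear {J : Finset (Fin n)} {γ : Fin n → Fin n → F}
    {y : Fin n → MvPolynomial (Fin n) F}
    (hy : ∀ j ∉ J, bind₁ (shear J (-γ) y) (y j) = y j) (g : MvPolynomial (Fin n) F) :
    bind₁ (shear J (-γ) y) (bind₁ (shear J γ y) g) = g := by
  have : (bind₁ (shear J (-γ) y)).comp (bind₁ (shear J γ y)) =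
      AlgHom.id F (MvPolynomial (Fin n) F) := by
    ext1 i
    rw [AlgHom.comp_apply, bind₁_X_right]
    by_cases hi : i ∈ J
    · rw [show shear J γ y i = X i - ∑ j ∈ Jᶜ, C (γ j i) * y j from if_pos hi,
        map_sub, bind₁_X_right, map_sum]
      have : ∑ j ∈ Jᶜ, bind₁ (shear J (-γ) y) (C (γ j i) * y j) = ∑ j ∈ Jᶜ, C (γ j i) * y j := by
        refine Finset.sum_congr rfl fun j hj => ?_
        rw [map_mul, bind₁_C_right, hy j (by simpa using hj)]
      rw [this, shear, if_pos hi]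
      simp
    · rw [show shear J γ y i = X i from if_neg hi, bind₁_X_right, shear, if_neg hi]
      simp
  exact congrArg (fun φ : MvPolynomial (Fin n) F →ₐ[F] MvPolynomial (Fin n) F => φ g) this

lemma bind₁_shear_X {J : Finset (Fin n)} {γ : Fin n → Fin n → F}
    {y : Fin n → MvPolynomial (Fin n) F} {j : Fin n} (hj : j ∉ J) :
    bind₁ (shear J γ y) (X j) = X j := by
  rw [bind₁_X_right, shear, if_neg hj]

lemma bind₁_shear_restrictHom_X {J S : Finset (Fin n)} {γ : Fin n → Fin n → F} {a : Fin n → F}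
    {y : Fin n → MvPolynomial (Fin n) F} {j : Fin n} (hj : j ∉ J) :
    bind₁ (shear J γ y) (restrictHom S a (X j)) = restrictHom S a (X j) := by
  rw [restrictHom_X]
  split_ifs
  · exact bind₁_shear_X hj
  · rw [bind₁_C_right]

/-- The reason for the parameter `y` of `shear`: restriction intertwines the shear by variables with
the shear by restricted variables. The latter is still affine and invertible, so invariance
codimensions of restrictions do not change. -/
lemma restrictHom_bind₁_shear {J S : Finset (Fin n)} (hJS : J ⊆ S) (γ : Fin n → Fin n → F)
    (a : Fin n → F) (g : MvPolynomial (Fin n) F) :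
    restrictHom S a (bind₁ (shear J γ X) g) =
      bind₁ (shear J γ fun j => restrictHom S a (X j)) (restrictHom S a g) := by
  have : (restrictHom S a).comp (bind₁ (shear J γ X)) =
      (bind₁ (shear J γ fun j => restrictHom S a (X j))).comp (restrictHom S a) := by
    ext1 i
    rw [AlgHom.comp_apply, AlgHom.comp_apply, bind₁_X_right]
    by_cases hi : i ∈ J
    · rw [restrictHom_X, if_pos (hJS hi), bind₁_X_right, shear, shear, if_pos hi, if_pos hi,
        map_sub, map_sum, restrictHom_X, if_pos (hJS hi)]
      simp only [map_mul, restrictHom_C]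
    · rw [bind₁_shear_restrictHom_X hi, shear, if_neg hi]
  exact congrArg (fun φ : MvPolynomial (Fin n) F →ₐ[F] MvPolynomial (Fin n) F => φ g) this

lemma totalDegree_restrictHom_X_le (S : Finset (Fin n)) (a : Fin n → F) (j : Fin n) :
    (restrictHom S a (X j)).totalDegree ≤ 1 := by
  rw [restrictHom_X]
  split_ifs <;> simp

lemma invCodim_restrictSet_shear_le {J S : Finset (Fin n)} (hJS : J ⊆ S)
    (γ : Fin n → Fin n → F) (a : Fin n → F) (G : Set (MvPolynomial (Fin n) F)) :
    invCodim (restrictSet (bind₁ (shear J γ X) '' G) S a) ≤ invCodim (restrictSet G S a) := by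
  have : restrictSet (bind₁ (shear J γ X) '' G) S a =
      bind₁ (shear J γ fun j => restrictHom S a (X j)) '' restrictSet G S a := by
    simp only [restrictSet, Set.image_image, restrictHom_bind₁_shear hJS]
  rw [this]
  exact invCodim_image_bind₁_le (totalDegree_shear_le (totalDegree_restrictHom_X_le S a)) _

lemma invCodim_restrictSet_shear {J S : Finset (Fin n)} (hJS : J ⊆ S)
    (γ : Fin n → Fin n → F) (a : Fin n → F) (G : Set (MvPolynomial (Fin n) F)) :
    invCodim (restrictSet (bind₁ (shear J γ X) '' G) S a) = invCodim (restrictSet G S a) := by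
  refine le_antisymm (invCodim_restrictSet_shear_le hJS γ a G) ?_
  have h := invCodim_restrictSet_shear_le hJS (-γ) a (bind₁ (shear J γ X) '' G)
  rw [Set.image_image] at h
  simp only [bind₁_shear_shear fun j hj => bind₁_shear_X (γ := -γ) (y := X) hj, Set.image_id'] at h
  exact h

lemma pderiv_bind₁ {u : Fin n → MvPolynomial (Fin n) F} (hu : ∀ i, (u i).totalDegree ≤ 1)
    (k : Fin n) (g : MvPolynomial (Fin n) F) :
    pderiv k (bind₁ u g) = bind₁ u (∑ i, C (linCoeff (u i) k) * pderiv i g) := by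
  have h := congrArg (fun q : Polynomial (MvPolynomial (Fin n) F) => q.coeff 1)
    (formalShift_bind₁ hu (Pi.single k 1) g)
  simp only [Polynomial.coeff_map, formalShift_coeff_one] at h
  rw [Finset.sum_eq_single k (fun j _ hj => by simp [hj]) (by simp)] at h
  rw [Pi.single_eq_same, map_one, one_mul] at h
  rw [h]
  have h2 : ∀ i, linPart u (Pi.single k 1) i = linCoeff (u i) k := by
    intro i
    simp [linPart, Pi.single_apply]
  simp only [h2]
  rfl

lemma linCoeff_X (i k : Fin n) : linCoeff (X i : MvPolynomial (Fin n) F) k =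
    if i = k then 1 else 0 := by
  rw [linCoeff, coeff_X]
  simp only [Finsupp.single_left_inj one_ne_zero]

lemma linCoeff_shear {J : Finset (Fin n)} (γ : Fin n → Fin n → F) (i k : Fin n) :
    linCoeff (shear J γ X i) k =
      (if i = k then 1 else 0) - if i ∈ J ∧ k ∉ J then γ k i else 0 := by
  by_cases hi : i ∈ J
  · have h1 : linCoeff (shear J γ X i) k = linCoeff (X i) k -
        ∑ j ∈ Jᶜ, γ j i * linCoeff (X j : MvPolynomial (Fin n) F) k := by
      rw [shear, if_pos hi]
      simp only [linCoeff, coeff_sub, coeff_sum, coeff_C_mul]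
    simp only [h1, linCoeff_X, hi, true_and]
    simp
  · rw [shear, if_neg hi, linCoeff_X]
    simp [hi]

lemma pderiv_bind₁_shear_of_mem {J : Finset (Fin n)} (γ : Fin n → Fin n → F) {k : Fin n}
    (hk : k ∈ J) (g : MvPolynomial (Fin n) F) :
    pderiv k (bind₁ (shear J γ X) g) = bind₁ (shear J γ X) (pderiv k g) := by
  rw [pderiv_bind₁ (totalDegree_shear_le fun j => by simp)]
  congr 1
  simp [linCoeff_shear, hk]

lemma pderiv_bind₁_shear_of_notMem {J : Finset (Fin n)} {γ : Fin n → Fin n → F} {k : Fin n}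
    (hk : k ∉ J) {g : MvPolynomial (Fin n) F}
    (hg : pderiv k g = ∑ i ∈ J, C (γ k i) * pderiv i g) :
    pderiv k (bind₁ (shear J γ X) g) = 0 := by
  rw [pderiv_bind₁ (totalDegree_shear_le fun j => by simp)]
  simp only [linCoeff_shear, map_sub, sub_mul, Finset.sum_sub_distrib, hk, not_false_eq_true,
    and_true]
  rw [Finset.sum_eq_single k (fun j _ hj => by simp [hj]) (by simp), if_pos rfl, map_one, one_mul,
    hg]
  simp [apply_ite C, ite_mul, Finset.sum_ite_mem]

/-- After the shear the directions of invariance of the restrictions vanish on `J`. -/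
lemma eq_zero_of_mem_invSpace_shear {G : Set (MvPolynomial (Fin n) F)} {B S J : Finset (Fin n)}
    (hJB : J ⊆ B) (hBS : B ⊆ S) {γ : Fin n → Fin n → F} {a : Fin n → F}
    (hγ : ∀ k ∉ J, ∀ g ∈ G, pderiv k g = ∑ i ∈ J, C (γ k i) * pderiv i g)
    (hli : LinearIndependent F fun j : J => restrictDeriv G B a j) {v : Fin n → F}
    (hv : v ∈ invSpace (restrictSet (bind₁ (shear J γ X) '' G) S a)) : ∀ i ∈ J, v i = 0 := by
  have hJS := hJB.trans hBS
  have key : ∀ g ∈ G, ∑ i ∈ J, C (v i) * restrictHom B a (pderiv i g) = 0 := by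
    intro g hg
    have h1 : ∑ i, C (v i) * pderiv i (restrictHom S a (bind₁ (shear J γ X) g)) = 0 :=
      invSpace_le_derivSpace _ hv _ ⟨_, ⟨g, hg, rfl⟩, rfl⟩
    have h2 : ∑ i, C (v i) * pderiv i (restrictHom S a (bind₁ (shear J γ X) g)) =
        bind₁ (shear J γ fun j => restrictHom S a (X j))
          (∑ i ∈ J, C (v i) * restrictHom S a (pderiv i g)) := by
      rw [map_sum, ← Finset.sum_subset (Finset.subset_univ J)]
      · refine Finset.sum_congr rfl fun i hi => ?_
        rw [pderiv_restrictHom_of_mem a (hJS hi), pderiv_bind₁_shear_of_mem γ hi,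
          restrictHom_bind₁_shear hJS, map_mul, bind₁_C_right]
      · intro i _ hi
        by_cases hS : i ∈ S
        · rw [pderiv_restrictHom_of_mem a hS, pderiv_bind₁_shear_of_notMem hi (hγ i hi g hg),
            map_zero, mul_zero]
        · rw [pderiv_restrictHom_of_notMem a hS, mul_zero]
    rw [h2] at h1
    -- Undoing the shear and restricting further to `B` leaves a relation with constant coefficients
    -- `v i` between the derivatives that `hli` declares independent.
    have h3 := congrArg (bind₁ (shear J (-γ) fun j => restrictHom S a (X j))) h1
    rw [bind₁_shear_shear fun j hj => bind₁_shear_restrictHom_X hj, map_zero] at h3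
    have h4 := congrArg (restrictHom B a) h3
    simpa only [map_sum, map_mul, restrictHom_C, restrictHom_restrictHom hBS, map_zero] using h4
  have hon : LinearIndepOn F (restrictDeriv G B a) (J : Set (Fin n)) := hli
  rw [linearIndepOn_finset_iff] at hon
  refine hon v ?_
  funext g
  simpa [restrictDeriv, smul_eq_C_mul] using key g.1 g.2

/-! ### Coefficients over the variables of `J`, and extraction of `p`-th roots. -/

lemma coeff_coeff_eval₂Hom_map_C (A : MvPolynomial (Fin n) F →+* Polynomial (MvPolynomial (Fin n) F))
    (P : MvPolynomial (Fin n) (MvPolynomial (Fin n) F)) (k : ℕ) (m : Fin n →₀ ℕ) :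
    coeff m ((eval₂Hom ((Polynomial.mapRingHom
      (C : _ →+* MvPolynomial (Fin n) (MvPolynomial (Fin n) F))).comp A)
      (fun i => Polynomial.C (X i)) P).coeff k) = (A (coeff m P)).coeff k := by
  classical
  induction P using MvPolynomial.induction_on' with
  | monomial u c =>
    have h1 : (u.prod fun i e => (Polynomial.C (X i) :
        Polynomial (MvPolynomial (Fin n) (MvPolynomial (Fin n) F))) ^ e) =
        Polynomial.C (monomial u 1) := by
      rw [monomial_eq, map_mul, map_one, map_one, one_mul, Finsupp.prod, Finsupp.prod, map_prod]
      simp only [map_pow]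
    rw [coe_eval₂Hom, eval₂_monomial, h1, RingHom.comp_apply, Polynomial.coe_mapRingHom,
      Polynomial.coeff_mul_C, Polynomial.coeff_map, coeff_C_mul, coeff_monomial, coeff_monomial]
    split_ifs <;> simp
  | add P Q hP hQ =>
    rw [map_add, Polynomial.coeff_add, coeff_add, hP, hQ, coeff_add, map_add, Polynomial.coeff_add]

lemma map_splitHom_eq {J : Finset (Fin n)}
    {A : MvPolynomial (Fin n) F →ₐ[F] Polynomial (MvPolynomial (Fin n) F)}
    (h1 : ∀ i ∈ J, A (X i) = Polynomial.C (X i))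
    (h2 : ∀ i ∉ J, Polynomial.map (splitHom J).toRingHom (A (X i)) = Polynomial.map C (A (X i)))
    (g : MvPolynomial (Fin n) F) :
    Polynomial.map (splitHom J).toRingHom (A g) =
      eval₂Hom ((Polynomial.mapRingHom C).comp A.toRingHom)
        (fun i => Polynomial.C (X i)) (splitHom J g) := by
  have := MvPolynomial.ringHom_ext
    (f := (Polynomial.mapRingHom (splitHom J).toRingHom).comp A.toRingHom)
    (g := (eval₂Hom ((Polynomial.mapRingHom
      (C : _ →+* MvPolynomial (Fin n) (MvPolynomial (Fin n) F))).comp A.toRingHom)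
      (fun i => Polynomial.C (X i))).comp (splitHom J).toRingHom)
    (fun r => by
      have : A (C r) = Polynomial.C (C r) := by
        rw [← MvPolynomial.algebraMap_eq, A.commutes, Polynomial.algebraMap_apply]
      simp [this])
    (fun i => by
      simp only [RingHom.comp_apply, AlgHom.toRingHom_eq_coe, RingHom.coe_coe, splitHom_X]
      split_ifs with hi
      · rw [h1 i hi]
        simp [splitHom_X, hi]
      · simpa using h2 i hi)
  exact congrArg (fun φ : MvPolynomial (Fin n) F →+* _ => φ g) this

/-- Two homomorphisms that fix the variables in `J` and preserve the polynomials without them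
agree at `g` if and only if they agree at the coefficients of `g` with respect to these
variables. -/
lemma algHom_apply_eq_iff {J : Finset (Fin n)}
    {A A' : MvPolynomial (Fin n) F →ₐ[F] Polynomial (MvPolynomial (Fin n) F)}
    (h1 : ∀ i ∈ J, A (X i) = Polynomial.C (X i))
    (h2 : ∀ i ∉ J, Polynomial.map (splitHom J).toRingHom (A (X i)) = Polynomial.map C (A (X i)))
    (h1' : ∀ i ∈ J, A' (X i) = Polynomial.C (X i))
    (h2' : ∀ i ∉ J, Polynomial.map (splitHom J).toRingHom (A' (X i)) = Polynomial.map C (A' (X i)))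
    (g : MvPolynomial (Fin n) F) :
    A g = A' g ↔ ∀ m, A (coeff m (splitHom J g)) = A' (coeff m (splitHom J g)) := by
  have hinj : Function.Injective (Polynomial.map (splitHom J :
      MvPolynomial (Fin n) F →ₐ[F] _).toRingHom) :=
    Polynomial.map_injective _ (splitHom_injective J)
  rw [← hinj.eq_iff, map_splitHom_eq h1 h2, map_splitHom_eq h1' h2', Polynomial.ext_iff]
  simp only [MvPolynomial.ext_iff, coeff_coeff_eval₂Hom_map_C]
  constructor
  · intro h m
    ext1 k
    ext1 m'
    exact h k m m'
  · intro h k m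
    simp only [AlgHom.toRingHom_eq_coe, RingHom.coe_coe, h m, implies_true]

/-- Both the shifted and the unshifted restriction fix the variables of `J` and introduce none of
them elsewhere, so invariance can be tested on each coefficient. -/
lemma invariantAlong_restrictHom_iff {J S : Finset (Fin n)} (hJS : J ⊆ S) {a v : Fin n → F}
    (hv : ∀ i ∈ J, v i = 0) (g : MvPolynomial (Fin n) F) :
    InvariantAlong (restrictHom S a g) v ↔
      ∀ m, InvariantAlong (restrictHom S a (coeff m (splitHom J g))) v := by
  let A' : MvPolynomial (Fin n) F →ₐ[F] Polynomial (MvPolynomial (Fin n) F) :=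
    Polynomial.CAlgHom.comp (restrictHom S a)
  have hA' : ∀ q, A' q = Polynomial.C (restrictHom S a q) := fun q => rfl
  have := algHom_apply_eq_iff (J := J) (A := (formalShift v).comp (restrictHom S a))
    (A' := A') ?_ ?_ ?_ ?_ g
  · exact this
  · intro i hi
    rw [AlgHom.comp_apply, restrictHom_X, if_pos (hJS hi), formalShift_X, hv i hi]
    simp
  · intro i hi
    rw [AlgHom.comp_apply, restrictHom_X]
    split_ifs with hS
    · rw [formalShift_X]
      simp [splitHom_X, hi]
    · rw [formalShift_C]
      simp
  · intro i hi
    rw [hA', restrictHom_X, if_pos (hJS hi)]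
  · intro i hi
    rw [hA', restrictHom_X]
    split_ifs with hS
    · simp [splitHom_X, hi]
    · simp

lemma exists_of_mem_support_coeff_splitHom {J : Finset (Fin n)} {g : MvPolynomial (Fin n) F}
    {m s' : Fin n →₀ ℕ} (h : s' ∈ (coeff m (splitHom J g)).support) :
    ∃ s ∈ g.support, s' = s.filter (· ∉ J) := by
  classical
  rw [g.as_sum, map_sum, coeff_sum] at h
  obtain ⟨s, hs, h⟩ := Finset.mem_biUnion.1 (support_sum h)
  refine ⟨s, hs, ?_⟩
  rw [splitHom_monomial, coeff_monomial] at h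
  split_ifs at h
  · exact Finset.mem_singleton.1 (support_monomial_subset h)
  · simp at h

lemma natCast_exponent_eq_zero {g : MvPolynomial (Fin n) F} {i : Fin n} (hg : pderiv i g = 0)
    {s : Fin n →₀ ℕ} (hs : s ∈ g.support) : (s i : F) = 0 := by
  by_cases h0 : s i = 0
  · rw [h0, Nat.cast_zero]
  have h1 := congrArg (coeff (s - Finsupp.single i 1)) hg
  rw [coeff_pderiv, coeff_zero] at h1
  have h2 : s - Finsupp.single i 1 + Finsupp.single i 1 = s :=
    tsub_add_cancel_of_le (Finsupp.single_le_iff.2 (Nat.one_le_iff_ne_zero.2 h0))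
  rw [h2] at h1
  have h3 := (mul_eq_zero.1 h1).resolve_left (mem_support_iff.1 hs)
  rw [← h3]
  have h4 := congrArg (fun t : Fin n →₀ ℕ => (t i : F)) h2
  simp only [Finsupp.add_apply, Finsupp.single_eq_same] at h4
  rw [← h4]
  push_cast
  rfl

lemma notMem_vars_of_pderiv_eq_zero [CharZero F] {g : MvPolynomial (Fin n) F} {i : Fin n}
    (hg : pderiv i g = 0) : i ∉ g.vars := by
  intro hi
  obtain ⟨s, hs, hsi⟩ := (mem_vars_iff_mem_support i).1 hi
  exact (Finsupp.mem_support_iff.1 hsi) (Nat.cast_eq_zero.1 (natCast_exponent_eq_zero hg hs))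

section CharP

variable {p : ℕ} [Fact p.Prime] [CharP F p]

lemma coeff_pow_char {g : MvPolynomial (Fin n) F} (m : Fin n →₀ ℕ) :
    coeff (p • m) (g ^ p) = coeff m g ^ p := by
  rw [← MvPolynomial.map_frobenius_expand (p := p), coeff_map,
    MvPolynomial.coeff_expand_smul _ (Fact.out : p.Prime).ne_zero]
  rfl

lemma polynomial_coeff_pow_char {u : Polynomial (MvPolynomial (Fin n) F)} (k : ℕ) :
    (u ^ p).coeff (k * p) = u.coeff k ^ p := by
  rw [← Polynomial.map_frobenius_expand (p := p), Polynomial.coeff_map,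
    Polynomial.coeff_expand_mul (Fact.out : p.Prime).pos]
  rfl

/-- The coefficient of `u e ^ p` at `p` times an exponent is a `p`-th power of a scalar, so each
such position gives a relation between the `b e` over the subfield of `p`-th powers. -/
lemma eq_zero_of_sum_mul_pow_char {ι : Type*}
    {b : ι → F} (hb : LinearIndependent (frobenius F p).fieldRange b) (E : Finset ι)
    {u : ι → Polynomial (MvPolynomial (Fin n) F)}
    (h : ∑ e ∈ E, Polynomial.C (C (b e)) * u e ^ p = 0) : ∀ e ∈ E, u e = 0 := by
  intro e he
  ext1 k
  ext1 m
  have h1 := congrArg (fun q : Polynomial (MvPolynomial (Fin n) F) =>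
    coeff (p • m) (q.coeff (k * p))) h
  simp only [Polynomial.finsetSum_coeff, Polynomial.coeff_C_mul, coeff_sum, coeff_C_mul,
    polynomial_coeff_pow_char, coeff_pow_char, Polynomial.coeff_zero, coeff_zero] at h1
  have h2 := (linearIndependent_iff'.1 hb) E
    (fun e => ⟨coeff m ((u e).coeff k) ^ p, ⟨coeff m ((u e).coeff k), rfl⟩⟩) (by
      rw [← h1]
      exact Finset.sum_congr rfl fun e _ => mul_comm _ _) e he
  simpa using eq_zero_of_pow_eq_zero (congrArg Subtype.val h2)

/-- A polynomial in the `p`-th powers of the variables is a combination of `p`-th powers. -/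
lemma exists_pth_roots {h : MvPolynomial (Fin n) F} (hp : ∀ s ∈ h.support, ∀ i, p ∣ s i) :
    ∃ K : Set (MvPolynomial (Fin n) F),
      (∀ u ∈ K, u.vars ⊆ h.vars ∧ p * u.totalDegree ≤ h.totalDegree) ∧
      ∀ A A' : MvPolynomial (Fin n) F →ₐ[F] Polynomial (MvPolynomial (Fin n) F),
        A h = A' h ↔ ∀ u ∈ K, A u = A' u := by
  classical
  have hp0 : p ≠ 0 := (Fact.out : p.Prime).ne_zero
  -- `F` need not be perfect, so each coefficient is expanded in a basis over the subfield of `p`-th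
  -- powers; `E` collects the finitely many basis elements that occur.
  let b := Module.Basis.ofVectorSpace (frobenius F p).fieldRange F
  have hr : ∀ c : F, ∀ e, ∃ r : F, r ^ p = (b.repr c e : F) := fun c e => (b.repr c e).2
  choose r hr using hr
  let E := h.support.biUnion fun s => (b.repr (coeff s h)).support
  have hsum : ∀ s ∈ h.support, ∑ e ∈ E, b e * r (coeff s h) e ^ p = coeff s h := by
    intro s hs
    have h1 := b.linearCombination_repr (coeff s h)
    rw [Finsupp.linearCombination_apply, Finsupp.sum_of_support_subset (s := E) _
      (Finset.subset_biUnion_of_mem (fun s => (b.repr (coeff s h)).support) hs) _ (by simp)] at h1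
    conv_rhs => rw [← h1]
    refine Finset.sum_congr rfl fun e _ => ?_
    rw [hr, mul_comm]
    rfl
  let d : (Fin n →₀ ℕ) → (Fin n →₀ ℕ) := fun s => s.mapRange (· / p) (Nat.zero_div p)
  have hd : ∀ s ∈ h.support, p • d s = s := by
    intro s hs
    ext i
    simpa [d] using Nat.mul_div_cancel' (hp s hs i)
  let u := fun e => ∑ s ∈ h.support, monomial (d s) (r (coeff s h) e)
  have hu : ∀ e, u e ^ p = ∑ s ∈ h.support, monomial s (r (coeff s h) e ^ p) := by
    intro e
    rw [sum_pow_char]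
    refine Finset.sum_congr rfl fun s hs => ?_
    rw [monomial_pow, hd s hs]
  have hh : h = ∑ e ∈ E, C (b e) * u e ^ p := by
    conv_lhs => rw [h.as_sum]
    simp only [hu, Finset.mul_sum, C_mul_monomial]
    rw [Finset.sum_comm]
    refine Finset.sum_congr rfl fun s hs => ?_
    rw [← map_sum, hsum s hs]
  refine ⟨u '' E, ?_, fun A A' => ?_⟩
  · rintro _ ⟨e, -, rfl⟩
    constructor
    · intro i hi
      obtain ⟨s, hs, hi⟩ := Finset.mem_biUnion.1 (vars_sum_subset _ _ hi)
      obtain ⟨t, ht, hit⟩ := (mem_vars_iff_mem_support i).1 hi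
      have ht' := Finset.mem_singleton.1 (support_monomial_subset ht)
      subst ht'
      rw [mem_vars_iff_mem_support]
      refine ⟨s, hs, ?_⟩
      rw [Finsupp.mem_support_iff] at hit ⊢
      intro h0
      simp [d, h0] at hit
    · rw [mul_comm, ← Nat.le_div_iff_mul_le (Fact.out : p.Prime).pos]
      refine totalDegree_finsetSum_le fun s hs => (totalDegree_monomial_le _ _).trans ?_
      rw [Nat.le_div_iff_mul_le (Fact.out : p.Prime).pos]
      refine le_trans (le_of_eq ?_) (le_totalDegree hs)
      change (d s).degree * p = s.degree
      conv_rhs => rw [← hd s hs]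
      rw [map_nsmul, smul_eq_mul, mul_comm]
  · have hA : ∀ A : MvPolynomial (Fin n) F →ₐ[F] Polynomial (MvPolynomial (Fin n) F),
        A h = ∑ e ∈ E, Polynomial.C (C (b e)) * A (u e) ^ p := by
      intro A
      conv_lhs => rw [hh]
      rw [map_sum]
      refine Finset.sum_congr rfl fun e _ => ?_
      rw [map_mul, map_pow, ← MvPolynomial.algebraMap_eq, A.commutes, Polynomial.algebraMap_apply]
    constructor
    · rintro h1 _ ⟨e, he, rfl⟩
      refine sub_eq_zero.1 (eq_zero_of_sum_mul_pow_char b.linearIndependent E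
        (u := fun e => A (u e) - A' (u e)) ?_ e he)
      simp only [sub_pow_char, mul_sub, Finset.sum_sub_distrib]
      rw [← hA, ← hA, h1, sub_self]
    · intro h1
      rw [hA, hA]
      exact Finset.sum_congr rfl fun e he => by rw [h1 _ ⟨e, he, rfl⟩]

/-- Exponents outside `J` are divisible by `p`, so `H` can consist of the `p`-th roots of the
coefficients over the variables of `J`. One `H` serves all `S`, `a` and `v`, as the induction
compares `G` and `H` on several restrictions at once. -/
lemma exists_reduced_set {G : Set (MvPolynomial (Fin n) F)} {J : Finset (Fin n)} {d : ℕ}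
    (hd : ∀ g ∈ G, g.totalDegree ≤ d) (hG : ∀ g ∈ G, ∀ j ∉ J, pderiv j g = 0) :
    ∃ H : Set (MvPolynomial (Fin n) F), (∀ h ∈ H, p * h.totalDegree ≤ d) ∧
      (∀ h ∈ H, Disjoint h.vars J) ∧
      ∀ S a v, J ⊆ S → (∀ i ∈ J, v i = 0) →
        (v ∈ invSpace (restrictSet G S a) ↔ v ∈ invSpace (restrictSet H S a)) := by
  classical
  have key : ∀ g ∈ G, ∀ m, ∀ s ∈ (coeff m (splitHom J g)).support, ∀ i, p ∣ s i := by
    intro g hg m s' hs' i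
    obtain ⟨s, hs, rfl⟩ := exists_of_mem_support_coeff_splitHom hs'
    by_cases hi : i ∈ J
    · rw [Finsupp.filter_apply_neg _ _ (by simpa using hi)]
      exact dvd_zero p
    rw [Finsupp.filter_apply_pos (· ∉ J) _ hi, ← CharP.cast_eq_zero_iff F p]
    exact natCast_exponent_eq_zero (hG g hg i hi) hs
  choose! K hK hiff using fun g (hg : g ∈ G) (m : Fin n →₀ ℕ) =>
    exists_pth_roots (p := p) (key g hg m)
  refine ⟨{h | ∃ g ∈ G, ∃ m, h ∈ K g m}, ?_, ?_, ?_⟩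
  · rintro h ⟨g, hg, m, hm⟩
    exact ((hK g hg m h hm).2.trans (totalDegree_coeff_splitHom_le J g m)).trans (hd g hg)
  · rintro h ⟨g, hg, m, hm⟩
    refine Finset.disjoint_left.2 fun i hi hiJ => ?_
    have h1 := (hK g hg m h hm).1 hi
    obtain ⟨s', hs', hi'⟩ := (mem_vars_iff_mem_support i).1 h1
    obtain ⟨s, -, rfl⟩ := exists_of_mem_support_coeff_splitHom hs'
    rw [Finsupp.mem_support_iff, Finsupp.filter_apply_neg _ _ (by simpa using hiJ)] at hi'
    exact hi' rfl
  · intro S a v hJS hv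
    let A' : MvPolynomial (Fin n) F →ₐ[F] Polynomial (MvPolynomial (Fin n) F) :=
      Polynomial.CAlgHom.comp (restrictHom S a)
    have h1 : ∀ g ∈ G, InvariantAlong (restrictHom S a g) v ↔
        ∀ m, ∀ u ∈ K g m, InvariantAlong (restrictHom S a u) v := by
      intro g hg
      rw [invariantAlong_restrictHom_iff hJS hv]
      exact forall_congr' fun m => hiff g hg m ((formalShift v).comp (restrictHom S a)) A'
    constructor
    · rintro h _ ⟨u, ⟨g, hg, m, hm⟩, rfl⟩
      exact (h1 g hg).1 (h _ ⟨g, hg, rfl⟩) m u hm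
    · rintro h _ ⟨g, hg, rfl⟩
      exact (h1 g hg).2 fun m u hu => h _ ⟨u, ⟨g, hg, m, hu⟩, rfl⟩

end CharP

/-! ### Raising the invariance codimension by freeing two variables. -/

lemma totalDegree_bind₁_le {u : Fin n → MvPolynomial (Fin n) F} (hu : ∀ i, (u i).totalDegree ≤ 1)
    (g : MvPolynomial (Fin n) F) : (bind₁ u g).totalDegree ≤ g.totalDegree := by
  conv_lhs => rw [g.as_sum, map_sum]
  refine totalDegree_finsetSum_le fun s hs => ?_
  rw [bind₁_monomial]
  refine (totalDegree_mul _ _).trans ?_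
  rw [totalDegree_C, zero_add]
  refine (totalDegree_finsetProd _ _).trans (le_trans ?_ (le_totalDegree hs))
  refine Finset.sum_le_sum fun i _ => (totalDegree_pow _ _).trans ?_
  simpa using Nat.mul_le_mul_left (s i) (hu i)

/-- The derivatives of a restriction, extended by zero outside `S`. -/
def restrictDerivExt (G : Set (MvPolynomial (Fin n) F)) (S : Finset (Fin n)) (a : Fin n → F)
    (i : Fin n) : G → MvPolynomial (Fin n) F :=
  fun g => pderiv i (restrictHom S a g.1)

lemma restrictDerivExt_of_mem {G : Set (MvPolynomial (Fin n) F)} {S : Finset (Fin n)}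
    {a : Fin n → F} {i : Fin n} (hi : i ∈ S) :
    restrictDerivExt G S a i = restrictDeriv G S a i :=
  funext fun _ => pderiv_restrictHom_of_mem a hi _

lemma restrictDerivExt_of_notMem {G : Set (MvPolynomial (Fin n) F)} {S : Finset (Fin n)}
    {a : Fin n → F} {i : Fin n} (hi : i ∉ S) : restrictDerivExt G S a i = 0 :=
  funext fun _ => pderiv_restrictHom_of_notMem a hi _

lemma derivRank_restrictSet (G : Set (MvPolynomial (Fin n) F)) (S : Finset (Fin n))
    (a : Fin n → F) : derivRank (restrictSet G S a) =
      Module.finrank F (Submodule.span F (Set.range (restrictDerivExt G S a))) := by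
  have h1 : derivSpace (restrictSet G S a) =
      LinearMap.ker (Fintype.linearCombination F (restrictDerivExt G S a)) := by
    ext v
    rw [LinearMap.mem_ker, Fintype.linearCombination_apply, funext_iff, mem_derivSpace, restrictSet,
      Set.forall_mem_image, Subtype.forall]
    refine forall₂_congr fun g hg => ?_
    simp [restrictDerivExt, smul_eq_C_mul]
  have h2 := LinearMap.finrank_range_add_finrank_ker
    (Fintype.linearCombination F (restrictDerivExt G S a))
  have h3 := derivRank_add_finrank (restrictSet G S a)
  rw [Fintype.range_linearCombination, Module.finrank_fintype_fun_eq_card, Fintype.card_fin] at h2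
  rw [h1] at h3
  omega

lemma card_le_derivRank {G : Set (MvPolynomial (Fin n) F)} {S J : Finset (Fin n)}
    {a : Fin n → F} (hJS : J ⊆ S) (h : LinearIndependent F fun j : J => restrictDeriv G S a j) :
    J.card ≤ derivRank (restrictSet G S a) := by
  rw [derivRank_restrictSet]
  have h1 : (fun j : J => restrictDeriv G S a j) = fun j : J => restrictDerivExt G S a j :=
    funext fun j => (restrictDerivExt_of_mem (hJS j.2)).symm
  rw [h1] at h
  have h2 := finrank_span_eq_card h
  rw [Fintype.card_coe] at h2
  rw [← h2]
  have := Module.Finite.span_of_finite F (Set.finite_range (restrictDerivExt G S a))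
  refine Submodule.finrank_mono (Submodule.span_mono ?_)
  rintro _ ⟨j, rfl⟩
  exact ⟨j, rfl⟩

lemma exists_linearIndependent_restrictDeriv (G : Set (MvPolynomial (Fin n) F))
    (S : Finset (Fin n)) (a : Fin n → F) :
    ∃ J ⊆ S, J.card = derivRank (restrictSet G S a) ∧
      LinearIndependent F fun j : J => restrictDeriv G S a j := by
  classical
  have := Module.Finite.span_of_finite F (Set.finite_range (restrictDerivExt G S a))
  obtain ⟨b, hb, -, hli⟩ :=
    Submodule.exists_fun_fin_finrank_span_eq F (Set.range (restrictDerivExt G S a))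
  choose f hf using hb
  have hf' : restrictDerivExt G S a ∘ f = b := funext hf
  have hinj : Function.Injective f := fun i j hij => hli.injective (by rw [← hf, ← hf, hij])
  have hS : Finset.univ.image f ⊆ S := by
    intro j hj
    obtain ⟨i, -, rfl⟩ := Finset.mem_image.1 hj
    by_contra hn
    exact hli.ne_zero i (by rw [← hf, restrictDerivExt_of_notMem hn])
  refine ⟨Finset.univ.image f, hS, ?_, ?_⟩
  · rw [Finset.card_image_of_injective _ hinj, Finset.card_fin, derivRank_restrictSet]
  · rw [← hf'] at hli
    have h1 := (linearIndepOn_range_iff hinj _).2 hli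
    have h2 : LinearIndepOn F (restrictDerivExt G S a) (Finset.univ.image f : Finset (Fin n)) := by
      rwa [Finset.coe_image, Finset.coe_univ, Set.image_univ]
    have h3 : (fun j : (Finset.univ.image f : Finset (Fin n)) => restrictDeriv G S a j) =
        fun j : (Finset.univ.image f : Finset (Fin n)) => restrictDerivExt G S a j :=
      funext fun j => (restrictDerivExt_of_mem (hS j.2)).symm
    rw [h3]
    exact h2

lemma derivRank_restrictSet_le {G : Set (MvPolynomial (Fin n) F)} {B : Finset (Fin n)} {r : ℕ}
    (h : ∀ J ⊆ B, GenericIndep G B J → J.card ≤ r) (a : Fin n → F) :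
    derivRank (restrictSet G B a) ≤ r := by
  obtain ⟨J, hJ, hcard, hli⟩ := exists_linearIndependent_restrictDeriv G B a
  rw [← hcard]
  exact h J hJ (GenericIndep.of_restrict hli)

/-- Otherwise the larger restriction would be an affine substitution of the smaller one, which
cannot raise the derivative rank. -/
lemma invCodim_lt_of_derivRank_lt {G : Set (MvPolynomial (Fin n) F)} {B S : Finset (Fin n)}
    (hBS : B ⊆ S) {a : Fin n → F}
    (h : derivRank (restrictSet G B a) < derivRank (restrictSet G S a)) :
    invCodim (restrictSet G B a) < invCodim (restrictSet G S a) := by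
  by_contra hn
  obtain ⟨u, hu, hS⟩ := exists_affine_of_invCodim_le hBS (not_lt.1 hn)
  rw [hS] at h
  exact absurd (derivRank_image_bind₁_le hu _) (not_le.2 h)

lemma exists_maximal_genericIndep (G : Set (MvPolynomial (Fin n) F)) (B : Finset (Fin n)) :
    ∃ J ⊆ B, GenericIndep G B J ∧ ∀ K ⊆ B, GenericIndep G B K → K.card ≤ J.card := by
  classical
  have hne : (B.powerset.filter fun J => GenericIndep G B J).Nonempty := by
    refine ⟨∅, Finset.mem_filter.2 ⟨Finset.empty_mem_powerset B, ?_⟩⟩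
    exact linearIndependent_empty_type
  obtain ⟨J, hJ, hmax⟩ := Finset.exists_max_image _ Finset.card hne
  rw [Finset.mem_filter, Finset.mem_powerset] at hJ
  exact ⟨J, hJ.1, hJ.2, fun K hK hKG =>
    hmax K (Finset.mem_filter.2 ⟨Finset.mem_powerset.2 hK, hKG⟩)⟩

lemma restrictHom_of_vars_subset {S : Finset (Fin n)} {g : MvPolynomial (Fin n) F}
    (h : g.vars ⊆ S) (a : Fin n → F) : restrictHom S a g = g := by
  have := MvPolynomial.hom_congr_vars (f₁ := (restrictHom S a).toRingHom)
    (f₂ := RingHom.id (MvPolynomial (Fin n) F)) (p₁ := g) (p₂ := g)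
    (by ext r; simp)
    (fun i hi _ => by simp [restrictHom_X, h hi]) rfl
  exact this

/-- The invariance space of `G` is that of `H` cut by the vanishing on `J`, and the cut is
transversal because `H` does not involve `J`. The identity says that the codimensions differ by
`|J|`. -/
lemma invCodim_eq_add_of_mem_iff {G H : Set (MvPolynomial (Fin n) F)} {J : Finset (Fin n)}
    (hH : ∀ h ∈ H, Disjoint h.vars J) (hG : ∀ v ∈ invSpace G, ∀ i ∈ J, v i = 0)
    (hiff : ∀ v, (∀ i ∈ J, v i = 0) → (v ∈ invSpace G ↔ v ∈ invSpace H)) :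
    invCodim G + Module.finrank F (coordSpace Jᶜ : Submodule F (Fin n → F)) =
      invCodim H + n := by
  have h1 : invSpace G = invSpace H ⊓ coordSpace Jᶜ := by
    ext v
    rw [Submodule.mem_inf, mem_coordSpace]
    simp only [Finset.mem_compl, not_not]
    exact ⟨fun hv => ⟨(hiff v (hG v hv)).1 hv, hG v hv⟩, fun hv => (hiff v hv.2).2 hv.1⟩
  have h2 : invSpace H ⊔ coordSpace Jᶜ = ⊤ := by
    refine sup_eq_top_of_coordSpace_le (S := J) (fun v hv h hh => ?_) le_rfl
    exact invariantAlong_of_vars fun i hi => hv i (Finset.disjoint_left.1 (hH h hh) hi)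
  have h3 := Submodule.finrank_sup_add_finrank_inf_eq (invSpace H)
    (coordSpace Jᶜ : Submodule F (Fin n → F))
  rw [h2, ← h1, finrank_top, Module.finrank_fintype_fun_eq_card, Fintype.card_fin] at h3
  have h4 := invCodim_add_finrank G
  have h5 := invCodim_add_finrank H
  omega

lemma invCodim_eq_zero_of_totalDegree {G : Set (MvPolynomial (Fin n) F)}
    (h : ∀ g ∈ G, g.totalDegree = 0) : invCodim G = 0 := by
  have h1 : invSpace G = ⊤ := by
    rw [eq_top_iff]
    intro v _ g hg
    rw [totalDegree_eq_zero_iff_eq_C.1 (h g hg)]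
    exact formalShift_C v _
  have h2 := invCodim_add_finrank G
  rw [h1, finrank_top, Module.finrank_fintype_fun_eq_card, Fintype.card_fin] at h2
  omega

/-- If the invariance codimension drops under a sufficiently generic restriction, then freeing two
suitable variables raises it. -/
theorem exists_polynomial_of_invCodim_lt (d : ℕ) : ∀ G : Set (MvPolynomial (Fin n) F),
    (∀ g ∈ G, g.totalDegree ≤ d) → ∀ B : Finset (Fin n),
    ∃ Ψ : MvPolynomial (Fin n) F, Ψ ≠ 0 ∧ Ψ.totalDegree ≤ 2 * n * d ∧ ∀ a, eval a Ψ ≠ 0 →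
      invCodim (restrictSet G B a) < invCodim G →
      ∃ y z, invCodim (restrictSet G B a) <
        invCodim (restrictSet G (insert y (insert z B)) a) := by
  induction d using Nat.strong_induction_on with
  | _ d ih =>
  intro G hd B
  rcases Nat.eq_zero_or_pos d with rfl | hd0
  · refine ⟨1, one_ne_zero, by simp, fun a _ h => ?_⟩
    rw [invCodim_eq_zero_of_totalDegree fun g hg => Nat.le_zero.1 (hd g hg)] at h
    exact absurd h (Nat.not_lt_zero _)
  obtain ⟨J, hJB, hJ, hmax⟩ := exists_maximal_genericIndep G B
  -- Two free variables are used because a relation is known to avoid `z` only if `z` is free, and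
  -- `j` itself must be free for its derivative to survive the restriction.
  by_cases hcase : ∃ j ∉ J, ∃ z, GenericIndep G (insert z (insert j B)) (insert j J)
  · obtain ⟨j, hj, z, hjz⟩ := hcase
    obtain ⟨Ψ, hΨ, hdeg, hli⟩ := hjz.exists_minor hd
    refine ⟨Ψ, hΨ, hdeg.trans ?_, fun a ha _ => ⟨z, j, ?_⟩⟩
    · rw [mul_assoc]
      exact Nat.le_mul_of_pos_left _ two_pos
    · refine invCodim_lt_of_derivRank_lt
        ((Finset.subset_insert _ _).trans (Finset.subset_insert _ _)) ?_
      refine lt_of_le_of_lt (derivRank_restrictSet_le hmax a) ?_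
      refine lt_of_lt_of_le ?_ (card_le_derivRank
        ((Finset.insert_subset_insert j hJB).trans (Finset.subset_insert z _)) (hli a ha))
      rw [Finset.card_insert_of_notMem hj]
      exact Nat.lt_succ_self _
  push Not at hcase
  choose! γ hγ using fun j (hj : j ∉ J) => exists_constant_relation hJ hj (hcase j hj)
  obtain ⟨Δ, hΔ, hΔdeg, hli⟩ := hJ.exists_minor hd
  have hshear : ∀ g ∈ bind₁ (shear J γ X) '' G, ∀ j ∉ J, pderiv j g = 0 := by
    rintro _ ⟨g, hg, rfl⟩ j hj
    exact pderiv_bind₁_shear_of_notMem hj (hγ j hj g hg)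
  have hcodim : ∀ S a, J ⊆ S → invCodim (restrictSet (bind₁ (shear J γ X) '' G) S a) =
      invCodim (restrictSet G S a) := fun S a hS => invCodim_restrictSet_shear hS γ a G
  obtain ⟨p, hp⟩ := CharP.exists F
  rcases CharP.char_is_prime_or_zero F p with hprime | rfl
  · have : Fact p.Prime := ⟨hprime⟩
    have hd' : ∀ g ∈ bind₁ (shear J γ X) '' G, g.totalDegree ≤ d := by
      rintro _ ⟨g, hg, rfl⟩
      exact (totalDegree_bind₁_le (totalDegree_shear_le fun j => by simp) g).trans (hd g hg)
    obtain ⟨H, hHd, hHJ, hH⟩ := exists_reduced_set (p := p) hd' hshear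
    obtain ⟨Ψ, hΨ, hΨdeg, hΨa⟩ := ih (d / p) (Nat.div_lt_self hd0 hprime.one_lt) H
      (fun h hh => (Nat.le_div_iff_mul_le hprime.pos).2 (by rw [mul_comm]; exact hHd h hh)) B
    refine ⟨Δ * Ψ, mul_ne_zero hΔ hΨ, ?_, fun a ha h => ?_⟩
    · have h1 := totalDegree_mul Δ Ψ
      -- The minor costs `n * d` and the recursion `2 * n * (d / p) ≤ n * d`; this is why the bound
      -- carries the factor `2`.
      have h2 : d / p * 2 ≤ d :=
        (Nat.mul_le_mul_left _ hprime.two_le).trans (Nat.div_mul_le_self d p)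
      have h3 := Nat.mul_le_mul_left n h2
      nlinarith
    · rw [map_mul] at ha
      have key : ∀ S, B ⊆ S → invCodim (restrictSet G S a) +
          Module.finrank F (coordSpace Jᶜ : Submodule F (Fin n → F)) =
          invCodim (restrictSet H S a) + n := by
        intro S hBS
        rw [← hcodim S a (hJB.trans hBS)]
        refine invCodim_eq_add_of_mem_iff (J := J) ?_ (fun v hv => ?_) fun v hv =>
          hH S a v (hJB.trans hBS) hv
        · rintro _ ⟨h, hh, rfl⟩
          exact (hHJ h hh).mono_left ((vars_restrictHom S a h).trans Finset.inter_subset_left)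
        · exact eq_zero_of_mem_invSpace_shear hJB hBS hγ (hli a (left_ne_zero_of_mul ha)) hv
      have h1 := key B subset_rfl
      have h2 := key Finset.univ (Finset.subset_univ B)
      rw [restrictSet_univ, restrictSet_univ] at h2
      obtain ⟨y, z, hyz⟩ := hΨa a (right_ne_zero_of_mul ha) (by omega)
      have h3 := key (insert y (insert z B))
        ((Finset.subset_insert _ _).trans (Finset.subset_insert _ _))
      exact ⟨y, z, by omega⟩
  · have : CharZero F := CharP.charP_to_charZero F
    -- The sheared polynomials involve only variables of `J ⊆ B`, so restriction to `B` fixes them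
    -- and no drop can occur.
    refine ⟨1, one_ne_zero, by simp, fun a _ h => ?_⟩
    have h1 : restrictSet (bind₁ (shear J γ X) '' G) B a = bind₁ (shear J γ X) '' G := by
      have h2 : ∀ g ∈ bind₁ (shear J γ X) '' G, restrictHom B a g = g := by
        intro g hg
        refine restrictHom_of_vars_subset (fun i hi => hJB ?_) a
        by_contra hiJ
        exact notMem_vars_of_pderiv_eq_zero (hshear g hg i hiJ) hi
      rw [restrictSet, Set.image_congr h2, Set.image_id']
    have h2 := hcodim B a hJB
    have h3 := hcodim Finset.univ a (Finset.subset_univ J)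
    rw [restrictSet_univ, restrictSet_univ] at h3
    rw [← h2, h1, h3] at h
    exact absurd h (lt_irrefl _)

/-! ### Multilinear polynomials under derivatives, factors and restrictions. -/

lemma add_single_mem_support_of_mem_support_pderiv {g : MvPolynomial (Fin n) F} {i : Fin n}
    {s : Fin n →₀ ℕ} (hs : s ∈ (pderiv i g).support) : s + Finsupp.single i 1 ∈ g.support := by
  rw [mem_support_iff, coeff_pderiv] at hs
  exact mem_support_iff.2 (left_ne_zero_of_mul hs)

lemma vars_pderiv_subset (i : Fin n) (g : MvPolynomial (Fin n) F) : (pderiv i g).vars ⊆ g.vars := by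
  intro j hj
  obtain ⟨s, hs, hsj⟩ := (mem_vars_iff_mem_support j).1 hj
  refine (mem_vars_iff_mem_support j).2 ⟨_, add_single_mem_support_of_mem_support_pderiv hs, ?_⟩
  rw [Finsupp.mem_support_iff] at hsj ⊢
  rw [Finsupp.add_apply]
  omega

lemma notMem_vars_pderiv {g : MvPolynomial (Fin n) F} {i : Fin n} (hg : g.degreeOf i ≤ 1) :
    i ∉ (pderiv i g).vars := by
  intro hi
  obtain ⟨s, hs, hsi⟩ := (mem_vars_iff_mem_support i).1 hi
  have h1 := (monomial_le_degreeOf i (add_single_mem_support_of_mem_support_pderiv hs)).trans hg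
  rw [Finsupp.add_apply, Finsupp.single_eq_same] at h1
  rw [Finsupp.mem_support_iff] at hsi
  omega

lemma pderiv_ne_zero {g : MvPolynomial (Fin n) F} {i : Fin n} (hg : g.degreeOf i ≤ 1)
    (hi : i ∈ g.vars) : pderiv i g ≠ 0 := by
  intro h0
  obtain ⟨s, hs, hsi⟩ := (mem_vars_iff_mem_support i).1 hi
  have h1 := natCast_exponent_eq_zero h0 hs
  have h2 := (monomial_le_degreeOf i hs).trans hg
  rw [Finsupp.mem_support_iff] at hsi
  rw [show s i = 1 by omega, Nat.cast_one] at h1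
  exact one_ne_zero h1

lemma isMultilinearPoly_of_dvd {f g : MvPolynomial (Fin n) F} (hf : IsMultilinearPoly f)
    (h0 : f ≠ 0) (h : g ∣ f) : IsMultilinearPoly g := by
  obtain ⟨k, rfl⟩ := h
  intro i
  have := hf i
  rw [degreeOf_mul_eq (left_ne_zero_of_mul h0) (right_ne_zero_of_mul h0)] at this
  omega

lemma disjoint_vars_of_isMultilinearPoly_mul {f g : MvPolynomial (Fin n) F}
    (h : IsMultilinearPoly (f * g)) (h0 : f * g ≠ 0) : Disjoint f.vars g.vars := by
  refine Finset.disjoint_left.2 fun i hf hg => ?_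
  have := h i
  rw [degreeOf_mul_eq (left_ne_zero_of_mul h0) (right_ne_zero_of_mul h0)] at this
  rw [mem_vars_iff_degreeOf_ne_zero] at hf hg
  omega

lemma exponent_le_one {f : MvPolynomial (Fin n) F} (hf : IsMultilinearPoly f)
    {s : Fin n →₀ ℕ} (hs : s ∈ f.support) (i : Fin n) : s i ≤ 1 :=
  (monomial_le_degreeOf i hs).trans (hf i)

lemma totalDegree_le_of_isMultilinearPoly {f : MvPolynomial (Fin n) F} (hf : IsMultilinearPoly f) :
    f.totalDegree ≤ n := by
  refine Finset.sup_le fun s hs => ?_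
  refine (Finset.sum_le_card_nsmul _ _ 1 fun i _ => exponent_le_one hf hs i).trans ?_
  rw [smul_eq_mul, mul_one]
  exact (Finset.card_le_univ _).trans (Fintype.card_fin n).le

lemma degreeOf_restrictHom_le (S : Finset (Fin n)) (a : Fin n → F) (g : MvPolynomial (Fin n) F)
    (i : Fin n) : (restrictHom S a g).degreeOf i ≤ g.degreeOf i := by
  conv_lhs => rw [g.as_sum, map_sum]
  refine (degreeOf_sum_le _ _ _).trans (Finset.sup_le fun s hs => ?_)
  refine le_trans ?_ (monomial_le_degreeOf i hs)
  have h1 : restrictHom S a (monomial s (coeff s g)) =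
      C (coeff s g) * ∏ j ∈ s.support, restrictHom S a (X j) ^ s j := by
    rw [monomial_eq, map_mul, restrictHom_C, Finsupp.prod, map_prod]
    simp only [map_pow]
  rw [h1]
  refine (degreeOf_C_mul_le _ _ _).trans ((degreeOf_prod_le _ _ _).trans ?_)
  have h2 : ∀ j ∈ s.support, degreeOf i (restrictHom S a (X j) ^ s j) ≤
      if j = i then s i else 0 := by
    intro j _
    refine (degreeOf_pow_le _ _ _).trans ?_
    rw [restrictHom_X]
    split_ifs with hj hji hji
    · rw [hji, degreeOf_X_self, mul_one]
    · rw [degreeOf_X_of_ne (Ne.symm hji), mul_zero]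
    · simp
    · simp
  refine (Finset.sum_le_sum h2).trans ?_
  rw [Finset.sum_ite_eq']
  split_ifs <;> simp

lemma totalDegree_restrictHom_le (S : Finset (Fin n)) (a : Fin n → F)
    (g : MvPolynomial (Fin n) F) : (restrictHom S a g).totalDegree ≤ g.totalDegree :=
  totalDegree_bind₁_le (fun i => by split_ifs <;> simp) g

lemma isMultilinearPoly_restrictHom {f : MvPolynomial (Fin n) F} (hf : IsMultilinearPoly f)
    (S : Finset (Fin n)) (a : Fin n → F) : IsMultilinearPoly (restrictHom S a f) :=
  fun i => (degreeOf_restrictHom_le S a f i).trans (hf i)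

lemma restrictHom_congr {S T : Finset (Fin n)} {g : MvPolynomial (Fin n) F}
    (h : ∀ i ∈ g.vars, i ∈ S ↔ i ∈ T) (a : Fin n → F) : restrictHom S a g = restrictHom T a g := by
  have := MvPolynomial.hom_congr_vars (f₁ := (restrictHom S a).toRingHom)
    (f₂ := (restrictHom T a).toRingHom) (p₁ := g) (p₂ := g)
    (by ext r; simp)
    (fun i hi _ => by simp [restrictHom_X, h i hi]) rfl
  exact this

lemma restrictHom_ne_zero {g : MvPolynomial (Fin n) F} {a : Fin n → F} (h : eval a g ≠ 0)
    (S : Finset (Fin n)) : restrictHom S a g ≠ 0 := by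
  intro h0
  rw [← eval_restrictHom S, h0, map_zero] at h
  exact h rfl

/-! ### Excluding linear factors of restrictions. -/

/-- The numerator `g ∂ᵢ∂ⱼg - ∂ᵢg ∂ⱼg` of the mixed second logarithmic derivative. -/
def logHessian (i j : Fin n) (g : MvPolynomial (Fin n) F) : MvPolynomial (Fin n) F :=
  g * pderiv i (pderiv j g) - pderiv i g * pderiv j g

lemma totalDegree_logHessian_le (i j : Fin n) (g : MvPolynomial (Fin n) F) :
    (logHessian i j g).totalDegree ≤ 2 * g.totalDegree := by
  have hi := totalDegree_pderiv_le i g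
  have hj := totalDegree_pderiv_le j g
  have hij := totalDegree_pderiv_le i (pderiv j g)
  refine (totalDegree_sub _ _).trans (max_le ?_ ?_)
  · refine (totalDegree_mul _ _).trans ?_
    omega
  · refine (totalDegree_mul _ _).trans ?_
    omega

/-- If it vanished, the prime `g` would divide `∂ᵢg` or `∂ⱼg`. By multilinearity these are nonzero
and free of the variable of differentiation, which occurs in `g`. -/
lemma logHessian_ne_zero {g : MvPolynomial (Fin n) F} (hg : IsMultilinearPoly g)
    (hirr : Irreducible g) {i j : Fin n} (hi : i ∈ g.vars) (hj : j ∈ g.vars) :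
    logHessian i j g ≠ 0 := by
  intro h0
  have hd : g ∣ pderiv i g * pderiv j g := ⟨_, (sub_eq_zero.1 h0).symm⟩
  have hno : ∀ k ∈ g.vars, ¬ g ∣ pderiv k g := fun k hk hdvd =>
    notMem_vars_pderiv (hg k) (vars_subset_of_dvd (pderiv_ne_zero (hg k) hk) hdvd hk)
  rcases hirr.prime.dvd_or_dvd hd with h | h
  · exact hno i hi h
  · exact hno j hj h

lemma logHessian_restrictHom {S : Finset (Fin n)} {i j : Fin n} (hi : i ∈ S) (hj : j ∈ S)
    (a : Fin n → F) (g : MvPolynomial (Fin n) F) :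
    logHessian i j (restrictHom S a g) = restrictHom S a (logHessian i j g) := by
  rw [logHessian, logHessian, pderiv_restrictHom_of_mem a hj, pderiv_restrictHom_of_mem a hi,
    pderiv_restrictHom_of_mem a hi, map_sub, map_mul, map_mul]

lemma logHessian_mul_eq_zero {f g : MvPolynomial (Fin n) F} (hd : Disjoint f.vars g.vars)
    {i j : Fin n} (hi : i ∈ f.vars) (hj : j ∈ g.vars) : logHessian i j (f * g) = 0 := by
  have hig : i ∉ g.vars := Finset.disjoint_left.1 hd hi
  have h1 : pderiv i g = 0 := pderiv_eq_zero_of_notMem_vars hig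
  have h2 : pderiv j f = 0 := pderiv_eq_zero_of_notMem_vars (Finset.disjoint_right.1 hd hj)
  have h3 : pderiv i (pderiv j g) = 0 :=
    pderiv_eq_zero_of_notMem_vars fun h => hig (vars_pderiv_subset j g h)
  simp only [logHessian, Derivation.leibniz, smul_eq_mul, h1, h2, h3, mul_zero, add_zero, zero_add]
  ring

/-- A linear factor would leave a nonconstant cofactor, by the degree bound, in disjoint variables;
a pair of indices taken from the two factors has vanishing `logHessian`. -/
lemma not_dvd_of_logHessian_ne_zero {g : MvPolynomial (Fin n) F} (hg : IsMultilinearPoly g)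
    (hH : ∀ i ∈ g.vars, ∀ j ∈ g.vars, logHessian i j g ≠ 0) (h2 : 2 ≤ g.totalDegree)
    {ℓ : MvPolynomial (Fin n) F} (hℓ : ℓ.totalDegree = 1) : ¬ ℓ ∣ g := by
  rintro ⟨k, rfl⟩
  have h0 : ℓ * k ≠ 0 := by
    intro h0
    rw [h0, totalDegree_zero] at h2
    omega
  have hd := disjoint_vars_of_isMultilinearPoly_mul hg h0
  have hne : ∀ q : MvPolynomial (Fin n) F, q.totalDegree ≠ 0 → ∃ i, i ∈ q.vars := by
    intro q hq
    by_contra hn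
    push Not at hn
    obtain ⟨c, rfl⟩ := exists_C_of_vars_eq_empty hn
    exact hq (totalDegree_C c)
  rw [totalDegree_mul_of_isDomain (left_ne_zero_of_mul h0) (right_ne_zero_of_mul h0)] at h2
  obtain ⟨i, hi⟩ := hne ℓ (by omega)
  obtain ⟨j, hj⟩ := hne k (by omega)
  exact hH i (vars_subset_of_dvd h0 (Dvd.intro _ rfl) hi) j
    (vars_subset_of_dvd h0 (Dvd.intro_left _ rfl) hj) (logHessian_mul_eq_zero hd hi hj)

lemma two_le_totalDegree_of_pderiv_pderiv_ne_zero {g : MvPolynomial (Fin n) F} {y z : Fin n}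
    (h : pderiv y (pderiv z g) ≠ 0) : 2 ≤ g.totalDegree := by
  obtain ⟨s, hs⟩ := support_nonempty.2 h
  have h1 : (s + Finsupp.single y 1 + Finsupp.single z 1).degree ≤ g.totalDegree :=
    le_totalDegree (add_single_mem_support_of_mem_support_pderiv
      (add_single_mem_support_of_mem_support_pderiv hs))
  rw [map_add, map_add, Finsupp.degree_single, Finsupp.degree_single] at h1
  omega

lemma exists_pderiv_pderiv_ne_zero {g : MvPolynomial (Fin n) F} (hg : IsMultilinearPoly g)
    (h2 : 2 ≤ g.totalDegree) : ∃ y z, y ≠ z ∧ pderiv y (pderiv z g) ≠ 0 := by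
  have h0 : g ≠ 0 := by
    rintro rfl
    simp at h2
  obtain ⟨s, hs, hdeg⟩ := Finset.exists_mem_eq_sup g.support (support_nonempty.2 h0)
    (fun s => s.sum fun _ e => e)
  have hcard : 1 < s.support.card := by
    have h3 : (s.sum fun _ e => e) ≤ s.support.card := by
      refine (Finset.sum_le_card_nsmul _ _ 1 fun i _ => exponent_le_one hg hs i).trans ?_
      rw [smul_eq_mul, mul_one]
    have h4 : g.totalDegree = s.sum fun _ e => e := hdeg
    omega
  obtain ⟨y, hy, z, hz, hyz⟩ := Finset.one_lt_card.1 hcard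
  have hval : ∀ i ∈ s.support, s i = 1 := fun i hi => by
    have := exponent_le_one hg hs i
    rw [Finsupp.mem_support_iff] at hi
    omega
  refine ⟨y, z, hyz, fun hzero => ?_⟩
  have h5 : s - Finsupp.single z 1 ∈ (pderiv z g).support := by
    have h6 : s - Finsupp.single z 1 + Finsupp.single z 1 = s :=
      tsub_add_cancel_of_le (Finsupp.single_le_iff.2 (hval z hz).ge)
    rw [mem_support_iff, coeff_pderiv, h6]
    simpa [hval z hz] using mem_support_iff.1 hs
  have h6 := natCast_exponent_eq_zero hzero h5
  simp [hval y hy, hyz.symm] at h6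

lemma invCodim_pos_of_pderiv_ne_zero {g : MvPolynomial (Fin n) F} {y : Fin n}
    (h : pderiv y g ≠ 0) : 0 < invCodim {g} := by
  by_contra h0
  have h1 := invCodim_add_finrank {g}
  have h2 : invSpace {g} = ⊤ := by
    apply Submodule.eq_top_of_finrank_eq
    rw [Module.finrank_fintype_fun_eq_card, Fintype.card_fin]
    omega
  have h3 : (Pi.single y 1 : Fin n → F) ∈ invSpace {g} := by
    rw [h2]
    trivial
  have h4 := invSpace_le_derivSpace _ h3 g rfl
  rw [Finset.sum_eq_single y (fun j _ hj => by simp [hj]) (by simp)] at h4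
  rw [Pi.single_eq_same, map_one, one_mul] at h4
  exact h h4

lemma totalDegree_restrictHom_mono {g : MvPolynomial (Fin n) F} {B S : Finset (Fin n)}
    (hBS : B ⊆ S) (a : Fin n → F) :
    (restrictHom B a g).totalDegree ≤ (restrictHom S a g).totalDegree := by
  rw [← restrictHom_restrictHom hBS]
  exact totalDegree_restrictHom_le _ _ _

/-- Evaluation at `a` is unaffected by restriction at `a`, so one condition on `a` covers every `S`
simultaneously. -/
lemma semRank_restrictHom {g : MvPolynomial (Fin n) F} (hg : IsMultilinearPoly g) {a : Fin n → F}
    (hH : ∀ i ∈ g.vars, ∀ j ∈ g.vars, eval a (logHessian i j g) ≠ 0) {S : Finset (Fin n)}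
    (h2 : 2 ≤ (restrictHom S a g).totalDegree) :
    semRank (restrictHom S a g) = invCodim (restrictSet {g} S a) := by
  have h0 : restrictHom S a g ≠ 0 := by
    intro h0
    rw [h0, totalDegree_zero] at h2
    omega
  rw [restrictSet, Set.image_singleton]
  refine semRank_eq_of_no_linear_factor h0 fun ℓ hℓ =>
    not_dvd_of_logHessian_ne_zero (isMultilinearPoly_restrictHom hg S a) (fun i hi j hj => ?_) h2 hℓ
  have hi' := Finset.mem_inter.1 (vars_restrictHom S a g hi)
  have hj' := Finset.mem_inter.1 (vars_restrictHom S a g hj)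
  rw [logHessian_restrictHom hi'.2 hj'.2]
  exact restrictHom_ne_zero (hH i hi'.1 j hj'.1) S

/-! ### The irreducible case and the passage to products. -/

lemma exists_polynomial_of_irreducible {g : MvPolynomial (Fin n) F} (hg : IsMultilinearPoly g)
    (hirr : Irreducible g) (B : Finset (Fin n)) :
    ∃ Ψ : MvPolynomial (Fin n) F, Ψ ≠ 0 ∧ Ψ.totalDegree ≤ 4 * n ^ 5 ∧ ∀ a, eval a Ψ ≠ 0 →
      eval a g ≠ 0 ∧ (semRank (restrictHom B a g) < semRank g →
        ∃ y z, semRank (restrictHom B a g) <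
          semRank (restrictHom (insert y (insert z B)) a g)) := by
  have hdeg := totalDegree_le_of_isMultilinearPoly hg
  rcases Nat.lt_or_ge 1 g.totalDegree with h2 | h1
  swap
  · refine ⟨g, hirr.ne_zero, ?_, fun a ha => ⟨ha, fun h => ?_⟩⟩
    · have := Nat.le_self_pow (n := 5) (by norm_num) n
      omega
    · rw [semRank_of_totalDegree_le_one hirr.ne_zero h1] at h
      exact absurd h (Nat.not_lt_zero _)
  -- This pair serves the case in which the restriction to `B` has degree at most one, hence rank
  -- `0`: with `∂y∂z g` nonzero at `a`, freeing `y` and `z` gives degree at least two and positive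
  -- rank.
  obtain ⟨y, z, hyz, hyz0⟩ := exists_pderiv_pderiv_ne_zero hg h2
  obtain ⟨Φ, hΦ, hΦdeg, hΦa⟩ := exists_polynomial_of_invCodim_lt n {g} (by simpa using hdeg) B
  let P : MvPolynomial (Fin n) F := ∏ ij ∈ g.vars ×ˢ g.vars, logHessian ij.1 ij.2 g
  have hP : P ≠ 0 := Finset.prod_ne_zero_iff.2 fun ij hij =>
    logHessian_ne_zero hg hirr (Finset.mem_product.1 hij).1 (Finset.mem_product.1 hij).2
  have hPdeg : P.totalDegree ≤ n * n * (2 * n) := by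
    refine (totalDegree_finsetProd _ _).trans ((Finset.sum_le_card_nsmul _ _ (2 * n)
      fun ij _ => (totalDegree_logHessian_le _ _ _).trans (Nat.mul_le_mul_left 2 hdeg)).trans ?_)
    rw [smul_eq_mul, Finset.card_product]
    have hcard : g.vars.card ≤ n := (Finset.card_le_univ _).trans (Fintype.card_fin n).le
    exact Nat.mul_le_mul_right _ (Nat.mul_le_mul hcard hcard)
  refine ⟨g * P * pderiv y (pderiv z g) * Φ,
    mul_ne_zero (mul_ne_zero (mul_ne_zero hirr.ne_zero hP) hyz0) hΦ, ?_, fun a ha => ?_⟩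
  · have h3 := totalDegree_mul (g * P * pderiv y (pderiv z g)) Φ
    have h4 := totalDegree_mul (g * P) (pderiv y (pderiv z g))
    have h5 := totalDegree_mul g P
    have h6 := (totalDegree_pderiv_le y (pderiv z g)).trans (totalDegree_pderiv_le z g)
    have hn : 2 ≤ n := (Nat.succ_le_of_lt h2).trans hdeg
    have h7 : 2 * (n * n) ≤ n * n * n := by
      rw [mul_comm 2]
      exact Nat.mul_le_mul_left _ hn
    have h8 : n * 2 ≤ n * n := Nat.mul_le_mul_left n hn
    have h9 : n ^ 5 = n * n * n * (n * n) := by ring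
    have h10 : n * n * n * 4 ≤ n * n * n * (n * n) :=
      Nat.mul_le_mul_left _ (Nat.mul_le_mul hn hn)
    have h11 : n * n * (2 * n) = 2 * (n * n * n) := by ring
    have h12 : 2 * n * n = 2 * (n * n) := by ring
    omega
  simp only [map_mul, mul_ne_zero_iff] at ha
  obtain ⟨⟨⟨hga, hPa⟩, hyza⟩, hΦ'⟩ := ha
  refine ⟨hga, fun h => ?_⟩
  have hH : ∀ i ∈ g.vars, ∀ j ∈ g.vars, eval a (logHessian i j g) ≠ 0 := by
    intro i hi j hj
    rw [map_prod] at hPa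
    exact Finset.prod_ne_zero_iff.1 hPa (i, j) (Finset.mk_mem_product hi hj)
  have hfull : semRank g = invCodim {g} := by
    have := semRank_restrictHom hg hH (S := Finset.univ) (by rwa [restrictHom_univ])
    rwa [restrictHom_univ, restrictSet_univ] at this
  rcases Nat.lt_or_ge 1 (restrictHom B a g).totalDegree with hB | hB
  · rw [semRank_restrictHom hg hH hB] at h ⊢
    rw [hfull] at h
    obtain ⟨y, z, hlt⟩ := hΦa a hΦ' h
    refine ⟨y, z, ?_⟩
    rwa [semRank_restrictHom hg hH (hB.trans_le (totalDegree_restrictHom_mono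
      ((Finset.subset_insert _ _).trans (Finset.subset_insert _ _)) a))]
  · refine ⟨y, z, ?_⟩
    rw [semRank_of_totalDegree_le_one (restrictHom_ne_zero hga B) hB]
    have hz : z ∈ insert y (insert z B) := by simp
    have hy : y ∈ insert y (insert z B) := by simp
    have h3 : pderiv y (pderiv z (restrictHom (insert y (insert z B)) a g)) ≠ 0 := by
      rw [pderiv_restrictHom_of_mem a hz, pderiv_restrictHom_of_mem a hy]
      exact restrictHom_ne_zero hyza _
    rw [semRank_restrictHom hg hH (two_le_totalDegree_of_pderiv_pderiv_ne_zero h3), restrictSet,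
      Set.image_singleton]
    refine invCodim_pos_of_pderiv_ne_zero (y := z) fun h0 => h3 ?_
    rw [h0, map_zero]

/-- If the rank of a product with disjoint variables drops, it drops in some factor; freeing
variables of that factor leaves the others untouched, hence `T ⊆ f.vars \ B`. Nonvanishing of `f` at
`a` keeps all restrictions nonzero, as additivity needs. Each irreducible factor costs `4 * n ^ 5`
and uses up at least one variable, whence the factor `f.vars.card`. -/
lemma exists_polynomial_of_isMultilinearPoly {f : MvPolynomial (Fin n) F} (h0 : f ≠ 0)
    (hf : IsMultilinearPoly f) (B : Finset (Fin n)) :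
    ∃ Ψ : MvPolynomial (Fin n) F, Ψ ≠ 0 ∧ Ψ.totalDegree ≤ 4 * n ^ 5 * f.vars.card ∧
      ∀ a, eval a Ψ ≠ 0 → eval a f ≠ 0 ∧ (semRank (restrictHom B a f) < semRank f →
        ∃ T ⊆ f.vars \ B, T.card ≤ 2 ∧
          semRank (restrictHom B a f) < semRank (restrictHom (B ∪ T) a f)) := by
  induction f using WfDvdMonoid.induction_on_irreducible with
  | zero => exact absurd rfl h0
  | unit u hu =>
    refine ⟨1, one_ne_zero, by simp, fun a _ => ⟨(hu.map (eval a)).ne_zero, fun h => ?_⟩⟩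
    rw [semRank_of_totalDegree_le_one hu.ne_zero
      (by rw [totalDegree_eq_zero_of_isUnit hu]; exact Nat.zero_le 1)] at h
    exact absurd h (Nat.not_lt_zero _)
  | mul g p hg hp ih =>
    rw [mul_comm p g] at h0 hf ⊢
    have hgm := isMultilinearPoly_of_dvd hf h0 (Dvd.intro _ rfl)
    have hpm := isMultilinearPoly_of_dvd hf h0 (Dvd.intro_left _ rfl)
    have hgv : g.vars ⊆ (g * p).vars := vars_subset_of_dvd h0 (Dvd.intro _ rfl)
    have hpv : p.vars ⊆ (g * p).vars := vars_subset_of_dvd h0 (Dvd.intro_left _ rfl)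
    have hd := disjoint_vars_of_isMultilinearPoly_mul hf h0
    obtain ⟨Ψ, hΨ, hΨdeg, hΨa⟩ := ih hg hgm
    obtain ⟨Φ, hΦ, hΦdeg, hΦa⟩ := exists_polynomial_of_irreducible hpm hp B
    refine ⟨Ψ * Φ, mul_ne_zero hΨ hΦ, ?_, fun a ha => ?_⟩
    · have hpos : 1 ≤ p.vars.card := by
        rw [Nat.one_le_iff_ne_zero, Ne, Finset.card_eq_zero]
        intro hempty
        obtain ⟨c, rfl⟩ := exists_C_of_vars_eq_empty (q := p) (by simp [hempty])
        exact hp.not_isUnit (isUnit_of_totalDegree_eq_zero hp.ne_zero (totalDegree_C c))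
      have hcard : g.vars.card + 1 ≤ (g * p).vars.card := by
        have := Finset.card_le_card (Finset.union_subset hgv hpv)
        rw [Finset.card_union_of_disjoint hd] at this
        omega
      have h1 := Nat.mul_le_mul_left (4 * n ^ 5) hcard
      have h2 := totalDegree_mul Ψ Φ
      rw [mul_add, mul_one] at h1
      omega
    rw [map_mul, mul_ne_zero_iff] at ha
    obtain ⟨hga, hgT⟩ := hΨa a ha.1
    obtain ⟨hpa, hpT⟩ := hΦa a ha.2
    have hmul : ∀ S, semRank (restrictHom S a (g * p)) =
        semRank (restrictHom S a g) + semRank (restrictHom S a p) := by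
      intro S
      rw [map_mul]
      exact semRank_mul_of_disjoint (restrictHom_ne_zero hga S) (restrictHom_ne_zero hpa S)
        (hd.mono ((vars_restrictHom S a g).trans Finset.inter_subset_left)
          ((vars_restrictHom S a p).trans Finset.inter_subset_left))
    refine ⟨by rw [map_mul]; exact mul_ne_zero hga hpa, fun h => ?_⟩
    simp only [hmul] at h ⊢
    rw [semRank_mul_of_disjoint hg hp.ne_zero hd] at h
    rcases Nat.lt_or_ge (semRank (restrictHom B a g)) (semRank g) with hlt | hge
    · obtain ⟨T, hT, hcard, hTlt⟩ := hgT hlt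
      refine ⟨T, hT.trans (Finset.sdiff_subset_sdiff hgv subset_rfl), hcard, ?_⟩
      rw [restrictHom_congr (S := B ∪ T) (T := B) (g := p) fun i hi => ?_]
      · omega
      · rw [Finset.mem_union, or_iff_left]
        exact fun hiT => Finset.disjoint_right.1 hd hi (Finset.mem_sdiff.1 (hT hiT)).1
    · obtain ⟨y, z, hyz⟩ := hpT (by omega)
      -- The irreducible case may return variables that lie in `B` or do not occur in `p`;
      -- discarding them does not change the restriction of `p`.
      have hT : ({y, z} ∩ p.vars) \ B ⊆ p.vars \ B :=
        Finset.sdiff_subset_sdiff Finset.inter_subset_right subset_rfl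
      refine ⟨({y, z} ∩ p.vars) \ B, hT.trans (Finset.sdiff_subset_sdiff hpv subset_rfl), ?_, ?_⟩
      · exact (Finset.card_le_card (Finset.sdiff_subset.trans Finset.inter_subset_left)).trans
          Finset.card_le_two
      · have h1 : restrictHom (B ∪ ({y, z} ∩ p.vars) \ B) a p =
            restrictHom (insert y (insert z B)) a p := restrictHom_congr (fun i hi => by
          by_cases hiB : i ∈ B <;> simp [hi, hiB]) a
        have h2 : restrictHom (B ∪ ({y, z} ∩ p.vars) \ B) a g = restrictHom B a g :=
          restrictHom_congr (fun i hi => by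
            rw [Finset.mem_union, or_iff_left]
            exact fun hiT => Finset.disjoint_left.1 hd hi (Finset.mem_sdiff.1 (hT hiT)).1) a
        rw [h1, h2]
        omega

end SemanticRank

end

theorem mainTheorem8 {F : Type*} [Field F] (n : ℕ) (f : MvPolynomial (Fin n) F)
    (hf : IsMultilinearPoly f) (B : Finset (Fin n)) :
    ∃ Ψ : MvPolynomial (Fin n) F, Ψ ≠ 0 ∧ Ψ.totalDegree ≤ 4 * n ^ 6 ∧
      ∀ a : Fin n → F, MvPolynomial.eval a Ψ ≠ 0 →
        semRank (restrictPoly f B a) < semRank f →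
        ∃ x y z w : Fin n, x ∉ B ∧ y ∉ B ∧ z ∉ B ∧ w ∉ B ∧
          semRank (restrictPoly f B a) < semRank (restrictPoly f (B ∪ {x, y, z, w}) a) := by
  rcases eq_or_ne f 0 with rfl | h0
  · refine ⟨1, one_ne_zero, by simp, fun a _ h => ?_⟩
    rw [SemanticRank.semRank_zero] at h
    exact absurd h (Nat.not_lt_zero _)
  obtain ⟨Ψ, hΨ, hdeg, hΨa⟩ := SemanticRank.exists_polynomial_of_isMultilinearPoly h0 hf B
  refine ⟨Ψ, hΨ, hdeg.trans ?_, fun a ha h => ?_⟩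
  · have hcard : f.vars.card ≤ n := (Finset.card_le_univ _).trans (Fintype.card_fin n).le
    exact (Nat.mul_le_mul_left _ hcard).trans (le_of_eq (by ring))
  obtain ⟨T, hT, hcard, hlt⟩ := (hΨa a ha).2 h
  have hTB : ∀ i ∈ T, i ∉ B := fun i hi => (Finset.mem_sdiff.1 (hT hi)).2
  have hxy : ∃ x y, T = {x, y} := by
    -- An empty `T` would make the strict inequality compare a rank with itself. So there is a
    -- variable outside `B` that can be repeated.
    have hpos : T.card ≠ 0 := by
      intro hT0
      rw [Finset.card_eq_zero.1 hT0, Finset.union_empty] at hlt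
      exact absurd hlt (lt_irrefl _)
    rcases (by omega : T.card = 1 ∨ T.card = 2) with h1 | h2
    · obtain ⟨x, rfl⟩ := Finset.card_eq_one.1 h1
      exact ⟨x, x, by simp⟩
    · obtain ⟨x, y, -, rfl⟩ := Finset.card_eq_two.1 h2
      exact ⟨x, y, rfl⟩
  obtain ⟨x, y, rfl⟩ := hxy
  have hx := hTB x (by simp)
  have hy := hTB y (by simp)
  refine ⟨x, x, x, y, hx, hx, hx, hy, ?_⟩
  rw [show ({x, x, x, y} : Finset (Fin n)) = {x, y} by simp]
  exact hlt
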